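/- Let $\mathcal A$ be a small abelian category which is finitary (all groups $\mathrm{Hom}(M,N)$ and $\mathrm{Ext}^1(M,N)$ are finite) and hereditary ($\mathrm{gldim}\,\mathcal A\le 1$). Let $\mathcal X$ be the set of isomorphism classes of objects, $K(\mathcal A)$ the Grothendieck group and $\overline M\in K(\mathcal A)$ the class of $M$. Let $\langle\ ,\ \rangle_m:K(\mathcal A)\times K(\mathcal A)\to\mathbb C$ be the multiplicative Euler form, i.e. a bimultiplicative form with $$\langle M,N\rangle_m^2=\prod_{i\ge 0}\bigl(\#\mathrm{Ext}^i(M,N)\bigr)^{(-1)^i}$$ for all objects $M,N$ (for example the one given by the positive square roots; any choice of square roots that is bimultiplicative is allowed), and let $(\alpha,\beta)_m=\langle\alpha,\beta\rangle_m\langle\beta,\alpha\rangle_m$. Let $a_M=\#\mathrm{Aut}(M)$, and let $P_{M,N}^R$ be the number of short exact sequences $0\to N\to R\to M\to 0$. The Hall algebra $H_{\mathcal A}=\bigoplus_{M\in\mathcal X}\mathbb C[M]$ has the product $$[M]\cdot[N]=\langle M,N\rangle_m\sum_R\frac{1}{a_Ma_N}P_{M,N}^R\,[R]$$ and the unit $[0]$.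 Let $H_{\mathcal A}\widehat\otimes H_{\mathcal A}$ be the space of all formal infinite linear combinations $\sum c_{M,N}[M]\otimes[N]$, and let $\Delta:H_{\mathcal A}\to H_{\mathcal A}\widehat\otimes H_{\mathcal A}$ be the linear map with $$\Delta([R])=\sum_{M,N}\langle M,N\rangle_m\frac1{a_R}P_{M,N}^R\,[M]\otimes[N].$$ Multiply basis tensors by the twisted rule $$([M]\otimes[N])\cdot([P]\otimes[Q])=(\overline N,\overline P)_m\,[M][P]\otimes[N][Q].$$ A product of two formal combinations $\sum_i c_i\,t_i$ and $\sum_j d_j\,t_j$ of basis tensors is called convergent if for every basis tensor $t$ the coefficient of $t$ in $c_id_j\,t_i\cdot t_j$ is nonzero for only finitely many pairs $(i,j)$; its value is then obtained by summing these coefficients. (1) $\Delta$ is a morphism of algebras: $\Delta([0])=[0]\otimes[0]$, and for all $x,y\in H_{\mathcal A}$ the product $\Delta(x)\cdot\Delta(y)$ is convergent and $\Delta(x\cdot y)=\Delta(x)\cdot\Delta(y)$. (2) Let $\widetilde H_{\mathcal A}=H_{\mathcal A}\otimes\mathbb C[K(\mathcal A)]$ be the extended Hall algebra, with basis $[M]\mathbf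 k_\alpha$ and product $$[M]\mathbf k_\alpha\cdot[N]\mathbf k_\beta=(\alpha,\overline N)_m\,([M]\cdot[N])\,\mathbf k_{\alpha+\beta}$$ (so that $\mathbf k_\alpha[M]\mathbf k_\alpha^{-1}=(\alpha,\overline M)_m[M]$), and put $$\Delta([R]\mathbf k_\alpha)=\sum_{M,N}\langle M,N\rangle_m\frac1{a_R}P_{M,N}^R\,[M]\mathbf k_{\overline N+\alpha}\otimes[N]\mathbf k_\alpha .$$ Then $\Delta:\widetilde H_{\mathcal A}\to\widetilde H_{\mathcal A}\widehat\otimes\widetilde H_{\mathcal A}$ is a morphism of algebras for the standard (untwisted) multiplication of tensors: it sends $1=[0]\mathbf k_0$ to $1\otimes 1$, and for all $x,y\in\widetilde H_{\mathcal A}$ the product $\Delta(x)\Delta(y)$ is convergent, in the same sense, and $\Delta(xy)=\Delta(x)\Delta(y)$. -/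

import Mathlib

open CategoryTheory Abelian
open scoped ZeroObject

universe w v u

namespace HallAlg

noncomputable section

/-- An abelian category is finitary if all its groups `Hom(M, N)` and `Ext¹(M, N)` are finite. -/
class Finitary (C : Type u) [Category.{v} C] [Abelian C] [HasExt.{w} C] : Prop where
  finite_hom : ∀ M N : C, Finite (M ⟶ N)
  finite_ext : ∀ M N : C, Finite (Ext.{w} M N 1)

/-- An abelian category is hereditary if it has global dimension at most one. -/
class Hereditary (C : Type u) [Category.{v} C] [Abelian C] : Prop where
  projectiveDimension_le : ∀ M : C, HasProjectiveDimensionLE M 1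

/-! ### The Grothendieck group -/

section K0

variable (C : Type u) [Category.{v} C] [Abelian C]

/-- The relations `[X₂] = [X₁] + [X₃]`, one for each short exact sequence
`0 ⟶ X₁ ⟶ X₂ ⟶ X₃ ⟶ 0`. -/
def K0Relations : AddSubgroup (FreeAbelianGroup C) :=
  AddSubgroup.closure {x | ∃ S : ShortComplex C, S.ShortExact ∧
    x = FreeAbelianGroup.of S.X₂ - (FreeAbelianGroup.of S.X₁ + FreeAbelianGroup.of S.X₃)}

/-- The Grothendieck group of an abelian category. -/
abbrev K0 : Type u := FreeAbelianGroup C ⧸ K0Relations C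

variable {C}

/-- The class of an object in the Grothendieck group. -/
def K0.of (M : C) : K0 C := QuotientAddGroup.mk (FreeAbelianGroup.of M)

theorem K0.of_shortExact {S : ShortComplex C} (hS : S.ShortExact) :
    K0.of S.X₂ = K0.of S.X₁ + K0.of S.X₃ := by
  have h : FreeAbelianGroup.of S.X₂ - (FreeAbelianGroup.of S.X₁ + FreeAbelianGroup.of S.X₃) ∈
      K0Relations C := AddSubgroup.subset_closure ⟨S, hS, rfl⟩
  have h' := (QuotientAddGroup.eq_zero_iff _).2 h
  exact sub_eq_zero.1 h'

/-- A function on objects that is additive on short exact sequences induces a homomorphism on the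
Grothendieck group. -/
def K0.lift {A : Type*} [AddCommGroup A] (f : C → A)
    (hf : ∀ S : ShortComplex C, S.ShortExact → f S.X₂ = f S.X₁ + f S.X₃) : K0 C →+ A :=
  QuotientAddGroup.lift _ (FreeAbelianGroup.lift f) (by
    rw [K0Relations, AddSubgroup.closure_le]
    rintro _ ⟨S, hS, rfl⟩
    simp [hf S hS])

theorem K0.lift_of {A : Type*} [AddCommGroup A] (f : C → A)
    (hf : ∀ S : ShortComplex C, S.ShortExact → f S.X₂ = f S.X₁ + f S.X₃) (M : C) :
    K0.lift f hf (K0.of M) = f M := by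
  change FreeAbelianGroup.lift f (FreeAbelianGroup.of M) = f M
  simp

theorem K0.hom_ext {A : Type*} [AddCommGroup A] {f g : K0 C →+ A}
    (h : ∀ M, f (K0.of M) = g (K0.of M)) : f = g := by
  refine DFunLike.ext _ _ fun x => ?_
  obtain ⟨x, rfl⟩ := QuotientAddGroup.mk_surjective x
  induction x using FreeAbelianGroup.induction_on with
  | zero => simp
  | of M => exact h M
  | neg M hM => rw [QuotientAddGroup.mk_neg, map_neg, map_neg, hM]
  | add x y hx hy => rw [QuotientAddGroup.mk_add, map_add, map_add, hx, hy]

theorem shortExact_of_iso {M N Z : C} (e : M ≅ N) (hZ : Limits.IsZero Z) :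
    (ShortComplex.mk e.hom (0 : N ⟶ Z) (by simp)).ShortExact := by
  have : Epi (0 : N ⟶ Z) := ⟨fun _ _ _ => hZ.eq_of_src _ _⟩
  refine { exact := ?_, mono_f := by dsimp; infer_instance, epi_g := this }
  rw [ShortComplex.exact_iff_epi _ rfl]
  dsimp
  infer_instance

theorem K0.of_isZero {Z : C} (hZ : Limits.IsZero Z) : K0.of Z = 0 := by
  have h := K0.of_shortExact (shortExact_of_iso (Iso.refl Z) hZ)
  dsimp at h
  simpa using h

theorem K0.of_iso {M N : C} (e : M ≅ N) : K0.of M = K0.of N := by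
  have h := K0.of_shortExact (shortExact_of_iso e (Limits.isZero_zero C))
  dsimp at h
  rw [K0.of_isZero (Limits.isZero_zero C), add_zero] at h
  exact h.symm

end K0

/-! ### The Euler form -/

section Euler

variable {C : Type u} [Category.{v} C] [Abelian C] [HasExt.{w} C]

/-- The square `∏ᵢ (# Extⁱ(M, N)) ^ (-1)ⁱ` of the multiplicative Euler form. -/
def eulerSq (M N : C) : ℝ :=
  ∏ᶠ i : ℕ, (Nat.card (Ext.{w} M N i) : ℝ) ^ ((-1 : ℤ) ^ i)

variable (C) in
/-- A choice of the multiplicative Euler form `⟨ , ⟩ₘ` on the Grothendieck group, that is, a choice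
of square roots of the numbers `∏ᵢ (# Extⁱ(M, N)) ^ (-1)ⁱ` which defines a bimultiplicative form on
the Grothendieck group. The choice of the positive square roots is `EulerForm.positive`. -/
structure EulerForm where
  /-- the value `⟨α, β⟩ₘ` -/
  form : K0 C → K0 C → ℂ
  add_left : ∀ α β γ, form (α + β) γ = form α γ * form β γ
  add_right : ∀ α β γ, form α (β + γ) = form α β * form α γ
  sq : ∀ M N : C, form (K0.of M) (K0.of N) ^ 2 = (eulerSq.{w} M N : ℂ)

/-- The symmetric Euler form `(α, β)ₘ = ⟨α, β⟩ₘ ⟨β, α⟩ₘ`. -/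
def EulerForm.symm (E : EulerForm.{w} C) (α β : K0 C) : ℂ := E.form α β * E.form β α

/-! The positive square roots define an Euler form. -/

theorem eulerSq_eq [Hereditary C] (M N : C) :
    eulerSq.{w} M N = Nat.card (Ext.{w} M N 0) / Nat.card (Ext.{w} M N 1) := by
  have h2 : ∀ i, i ∉ Finset.range 2 → Nat.card (Ext.{w} M N i) = 1 := by
    intro i hi
    have := Hereditary.projectiveDimension_le M
    have : Subsingleton (Ext.{w} M N i) :=
      HasProjectiveDimensionLT.subsingleton M 2 i (by simpa [Nat.succ_le_iff] using hi) N
    exact Nat.card_unique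
  rw [eulerSq, finprod_eq_prod_of_mulSupport_subset (s := Finset.range 2)]
  · simp [Finset.prod_range_succ, div_eq_mul_inv]
  · intro i hi
    by_contra h
    exact hi (by simp [h2 i h])

instance finite_ext_zero [Finitary.{w} C] (M N : C) : Finite (Ext.{w} M N 0) :=
  have := Finitary.finite_hom.{w} M N
  Finite.of_equiv _ Ext.homEquiv₀.symm

instance finite_ext_one [Finitary.{w} C] (M N : C) : Finite (Ext.{w} M N 1) :=
  Finitary.finite_ext M N

theorem log_card_ker_add_range {A B : Type*} [AddCommGroup A] [AddCommGroup B] [Finite A]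
    (f : A →+ B) :
    Real.log (Nat.card f.ker) + Real.log (Nat.card f.range) = Real.log (Nat.card A) := by
  have h1 : Nat.card A = Nat.card f.range * Nat.card f.ker := by
    rw [AddSubgroup.card_eq_card_quotient_mul_card_addSubgroup f.ker,
      Nat.card_congr (QuotientAddGroup.quotientKerEquivRange f).toEquiv]
  have : Finite f.range := Finite.of_surjective _ f.rangeRestrict_surjective
  rw [h1, Nat.cast_mul, Real.log_mul, add_comm]
  · exact_mod_cast Nat.card_pos.ne'
  · exact_mod_cast Nat.card_pos.ne'

theorem log_card_sixTerm {A₁ A₂ A₃ A₄ A₅ A₆ : Type*} [AddCommGroup A₁] [AddCommGroup A₂]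
    [AddCommGroup A₃] [AddCommGroup A₄] [AddCommGroup A₅] [AddCommGroup A₆]
    [Finite A₁] [Finite A₂] [Finite A₃] [Finite A₄] [Finite A₅]
    (f₁ : A₁ →+ A₂) (f₂ : A₂ →+ A₃) (f₃ : A₃ →+ A₄) (f₄ : A₄ →+ A₅) (f₅ : A₅ →+ A₆)
    (h₁ : f₁.ker = ⊥) (h₂ : f₂.ker = f₁.range) (h₃ : f₃.ker = f₂.range) (h₄ : f₄.ker = f₃.range)
    (h₅ : f₅.ker = f₄.range) (h₆ : f₅.range = ⊤) :
    Real.log (Nat.card A₂) - Real.log (Nat.card A₅) =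
      (Real.log (Nat.card A₁) - Real.log (Nat.card A₄)) +
        (Real.log (Nat.card A₃) - Real.log (Nat.card A₆)) := by
  have e₁ := log_card_ker_add_range f₁
  have e₂ := log_card_ker_add_range f₂
  have e₃ := log_card_ker_add_range f₃
  have e₄ := log_card_ker_add_range f₄
  have e₅ := log_card_ker_add_range f₅
  rw [h₁, AddSubgroup.card_bot, Nat.cast_one, Real.log_one] at e₁
  rw [h₂] at e₂
  rw [h₃] at e₃
  rw [h₄] at e₄
  rw [h₅, h₆, AddSubgroup.card_top] at e₅
  linarith

/-- The logarithm of `# Hom(M, N) / # Ext¹(M, N)`. -/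
def logEuler (M N : C) : ℝ :=
  Real.log (Nat.card (Ext.{w} M N 0)) - Real.log (Nat.card (Ext.{w} M N 1))

theorem logEuler_covariant [Finitary.{w} C] [Hereditary C] (M : C) (S : ShortComplex C)
    (hS : S.ShortExact) :
    logEuler.{w} M S.X₂ = logEuler.{w} M S.X₁ + logEuler.{w} M S.X₃ := by
  have hm : Mono S.f := hS.mono_f
  refine log_card_sixTerm ((Ext.mk₀ S.f).postcomp M (add_zero 0))
    ((Ext.mk₀ S.g).postcomp M (add_zero 0)) (hS.extClass.postcomp M (zero_add 1))
    ((Ext.mk₀ S.f).postcomp M (add_zero 1)) ((Ext.mk₀ S.g).postcomp M (add_zero 1))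
    ?_ ?_ ?_ ?_ ?_ ?_
  · rw [AddMonoidHom.ker_eq_bot_iff]
    exact Ext.postcomp_mk₀_injective_of_mono M S.f
  · ext x
    refine ⟨fun hx => Ext.covariant_sequence_exact₂ M hS x hx, ?_⟩
    rintro ⟨y, rfl⟩
    simp [AddMonoidHom.mem_ker]
  · ext x
    refine ⟨fun hx => Ext.covariant_sequence_exact₃ M hS x (zero_add 1) hx, ?_⟩
    rintro ⟨y, rfl⟩
    simp [AddMonoidHom.mem_ker, Ext.comp_assoc_of_second_deg_zero]
  · ext x
    refine ⟨fun hx => Ext.covariant_sequence_exact₁ M hS x hx (zero_add 1), ?_⟩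
    rintro ⟨y, rfl⟩
    simp [AddMonoidHom.mem_ker, Ext.comp_assoc_of_third_deg_zero]
  · ext x
    refine ⟨fun hx => Ext.covariant_sequence_exact₂ M hS x hx, ?_⟩
    rintro ⟨y, rfl⟩
    simp [AddMonoidHom.mem_ker]
  · rw [eq_top_iff]
    intro x _
    have := Hereditary.projectiveDimension_le M
    exact Ext.covariant_sequence_exact₃ M hS x (n₁ := 2) rfl
      (Ext.eq_zero_of_hasProjectiveDimensionLT _ 2 le_rfl)

theorem logEuler_contravariant [Finitary.{w} C] [Hereditary C] (N : C) (S : ShortComplex C)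
    (hS : S.ShortExact) :
    logEuler.{w} S.X₂ N = logEuler.{w} S.X₁ N + logEuler.{w} S.X₃ N := by
  have hm : Epi S.g := hS.epi_g
  rw [add_comm]
  refine log_card_sixTerm ((Ext.mk₀ S.g).precomp N (zero_add 0))
    ((Ext.mk₀ S.f).precomp N (zero_add 0)) (hS.extClass.precomp N (add_zero 1))
    ((Ext.mk₀ S.g).precomp N (zero_add 1)) ((Ext.mk₀ S.f).precomp N (zero_add 1))
    ?_ ?_ ?_ ?_ ?_ ?_
  · rw [AddMonoidHom.ker_eq_bot_iff]
    exact Ext.precomp_mk₀_injective_of_epi N S.g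
  · ext x
    refine ⟨fun hx => Ext.contravariant_sequence_exact₂ hS N x hx, ?_⟩
    rintro ⟨y, rfl⟩
    simp [AddMonoidHom.mem_ker]
  · ext x
    refine ⟨fun hx => Ext.contravariant_sequence_exact₁ hS N x (add_zero 1) hx, ?_⟩
    rintro ⟨y, rfl⟩
    simp [AddMonoidHom.mem_ker]
  · ext x
    refine ⟨fun hx => Ext.contravariant_sequence_exact₃ hS N x hx (add_zero 1), ?_⟩
    rintro ⟨y, rfl⟩
    simp [AddMonoidHom.mem_ker]
  · ext x
    refine ⟨fun hx => Ext.contravariant_sequence_exact₂ hS N x hx, ?_⟩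
    rintro ⟨y, rfl⟩
    simp [AddMonoidHom.mem_ker]
  · rw [eq_top_iff]
    intro x _
    have := Hereditary.projectiveDimension_le S.X₃
    exact Ext.contravariant_sequence_exact₁ hS N x (n₁ := 2) rfl
      (Ext.eq_zero_of_hasProjectiveDimensionLT _ 2 le_rfl)

variable (C) in
/-- The biadditive form on the Grothendieck group given by `logEuler` on classes of objects. -/
def logEulerHom [Finitary.{w} C] [Hereditary C] : K0 C →+ K0 C →+ ℝ :=
  K0.lift (fun M => K0.lift (logEuler.{w} M) (logEuler_covariant M)) (by
    intro S hS
    refine K0.hom_ext fun N => ?_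
    rw [AddMonoidHom.add_apply]
    simp only [K0.lift_of]
    exact logEuler_contravariant N S hS)

variable (C) in
/-- The Euler form given by the positive square roots. -/
def EulerForm.positive [Finitary.{w} C] [Hereditary C] : EulerForm.{w} C where
  form α β := (Real.exp (logEulerHom.{w} C α β / 2) : ℂ)
  add_left α β γ := by
    rw [map_add, AddMonoidHom.add_apply, add_div, Real.exp_add, Complex.ofReal_mul]
  add_right α β γ := by
    rw [map_add, add_div, Real.exp_add, Complex.ofReal_mul]
  sq M N := by
    rw [← Complex.ofReal_pow, ← Real.exp_nat_mul, eulerSq_eq]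
    have h : logEulerHom.{w} C (K0.of M) (K0.of N) = logEuler.{w} M N := by
      simp only [logEulerHom, K0.lift_of]
    rw [h, logEuler, Nat.cast_ofNat, mul_div_cancel₀ _ (two_ne_zero), Real.exp_sub,
      Real.exp_log, Real.exp_log]
    · exact_mod_cast Nat.card_pos
    · exact_mod_cast Nat.card_pos

end Euler

/-! ### Isomorphism classes and Hall numbers -/

section Hall

variable (C : Type u) [Category.{v} C]

/-- The set of isomorphism classes of objects. -/
abbrev IsoClass : Type u := Quotient (isIsomorphicSetoid C)

variable {C}

/-- The isomorphism class of an object. -/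
abbrev isoClass (M : C) : IsoClass C := Quotient.mk (isIsomorphicSetoid C) M

theorem out_iso (M : C) : Nonempty ((isoClass M).out ≅ M) :=
  Quotient.exact (s := isIsomorphicSetoid C) (Quotient.out_eq (isoClass M))

/-- The order `a_M` of the automorphism group of (a representative of) `M`. -/
def autCard (M : IsoClass C) : ℕ := Nat.card (Aut M.out)

theorem autCard_isoClass (M : C) : autCard (isoClass M) = Nat.card (Aut M) :=
  Nat.card_congr (Aut.autMulEquivOfIso (out_iso M).some).toEquiv

variable [Abelian C]

/-- The class in the Grothendieck group of an isomorphism class of objects. -/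
def IsoClass.toK0 : IsoClass C → K0 C :=
  Quotient.lift K0.of (fun _ _ ⟨e⟩ => K0.of_iso e)

/-- The set of short exact sequences `0 ⟶ N ⟶ R ⟶ M ⟶ 0`. -/
def exactSeqs (M N R : C) : Set ((N ⟶ R) × (R ⟶ M)) :=
  {p | ∃ h : p.1 ≫ p.2 = 0, (ShortComplex.mk p.1 p.2 h).ShortExact}

/-- The number of short exact sequences `0 ⟶ N ⟶ R ⟶ M ⟶ 0` between (representatives of) the
given isomorphism classes. -/
def hallP (M N R : IsoClass C) : ℕ := (exactSeqs M.out N.out R.out).ncard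

theorem exactSeqs_of_iso {M N R M' N' R' : C} (eM : M ≅ M') (eN : N ≅ N') (eR : R ≅ R')
    {p : (N ⟶ R) × (R ⟶ M)} (hp : p ∈ exactSeqs M N R) :
    (eN.inv ≫ p.1 ≫ eR.hom, eR.inv ≫ p.2 ≫ eM.hom) ∈ exactSeqs M' N' R' := by
  obtain ⟨h, hS⟩ := hp
  refine ⟨by simp [reassoc_of% h], ?_⟩
  refine ShortComplex.shortExact_of_iso (ShortComplex.isoMk eN eR eM ?_ ?_) hS
  · simp
  · simp

theorem hallP_isoClass (M N R : C) :
    hallP (isoClass M) (isoClass N) (isoClass R) = (exactSeqs M N R).ncard := by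
  obtain ⟨eM⟩ := out_iso M
  obtain ⟨eN⟩ := out_iso N
  obtain ⟨eR⟩ := out_iso R
  refine Set.ncard_congr
    (fun p _ => (eN.inv ≫ p.1 ≫ eR.hom, eR.inv ≫ p.2 ≫ eM.hom))
    (fun p hp => exactSeqs_of_iso eM eN eR hp) ?_ ?_
  · rintro ⟨a, b⟩ ⟨a', b'⟩ _ _ h
    simpa using h
  · rintro ⟨a, b⟩ hp
    exact ⟨_, exactSeqs_of_iso eM.symm eN.symm eR.symm hp, by simp⟩

variable [HasExt.{w} C]

/-- The middle term of an extension is determined up to isomorphism by its class in `Ext¹`. -/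
theorem nonempty_iso_of_extClass_eq {M N R R' : C} {a : N ⟶ R} {b : R ⟶ M} {a' : N ⟶ R'}
    {b' : R' ⟶ M} {h : a ≫ b = 0} {h' : a' ≫ b' = 0} (hS : (ShortComplex.mk a b h).ShortExact)
    (hS' : (ShortComplex.mk a' b' h').ShortExact)
    (hx : (hS.extClass : Ext.{w} M N 1) = hS'.extClass) : Nonempty (R ≅ R') := by
  have hab : Epi b := hS.epi_g
  obtain ⟨x, hx₁⟩ := Ext.contravariant_sequence_exact₁ hS R' (Ext.mk₀ a') (add_zero 1) (by
    rw [hx]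
    exact hS'.extClass_comp)
  obtain ⟨g, rfl⟩ := Ext.homEquiv₀.symm.surjective x
  have hg : a ≫ g = a' := by
    apply Ext.homEquiv₀.symm.injective
    simpa using hx₁
  have hg0 : a ≫ g ≫ b' = 0 := by rw [reassoc_of% hg, h']
  let k : M ⟶ M := hS.exact.desc (g ≫ b') hg0
  have hk : b ≫ k = g ≫ b' := hS.exact.g_desc (g ≫ b') hg0
  let φ : ShortComplex.mk a b h ⟶ ShortComplex.mk a' b' h' :=
    { τ₁ := 𝟙 N, τ₂ := g, τ₃ := k, comm₁₂ := by simp [hg], comm₂₃ := by simp [hk] }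
  have hn := ShortComplex.ShortExact.extClass_naturality.{w} hS hS' φ
  have hn' : (Ext.mk₀ (k - 𝟙 M)).comp hS'.extClass (zero_add 1) = 0 := by
    have e : (Ext.mk₀ k).comp hS'.extClass (zero_add 1) = hS'.extClass := by
      rw [← hx]
      simpa [φ, hx] using hn.symm
    rw [sub_eq_add_neg, Ext.mk₀_add, Ext.add_comp, e, Ext.mk₀_neg, Ext.neg_comp, Ext.mk₀_id_comp]
    exact add_neg_cancel _
  obtain ⟨y, hy⟩ := Ext.covariant_sequence_exact₃ M hS' (Ext.mk₀ (k - 𝟙 M)) (zero_add 1) hn'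
  obtain ⟨s, rfl⟩ := Ext.homEquiv₀.symm.surjective y
  have hs : s ≫ b' = k - 𝟙 M := by
    apply Ext.homEquiv₀.symm.injective
    simpa using hy
  let ψ : ShortComplex.mk a b h ⟶ ShortComplex.mk a' b' h' :=
    { τ₁ := 𝟙 N, τ₂ := g - b ≫ s, τ₃ := 𝟙 M
      comm₁₂ := by simp [hg, reassoc_of% h]
      comm₂₃ := by simp [hs, hk] }
  have : IsIso ψ.τ₁ := by dsimp [ψ]; infer_instance
  have : IsIso ψ.τ₃ := by dsimp [ψ]; infer_instance
  have : IsIso ψ.τ₂ := ShortComplex.isIso₂_of_shortExact_of_isIso₁₃ ψ hS hS'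
  exact ⟨asIso ψ.τ₂⟩

/-- There are only finitely many extensions of `M` by `N` up to isomorphism. -/
theorem finite_support_hallP [Finitary.{w} C] (M N : IsoClass C) :
    {R : IsoClass C | hallP M N R ≠ 0}.Finite := by
  have key : ∀ R : {R : IsoClass C | hallP M N R ≠ 0},
      ∃ p, p ∈ exactSeqs M.out N.out R.1.out := fun R =>
    Set.nonempty_of_ncard_ne_zero R.2
  choose p hp using key
  have : Finite {R : IsoClass C | hallP M N R ≠ 0} := by
    refine Finite.of_injective
      (fun R => show Ext.{w} M.out N.out 1 from (hp R).choose_spec.extClass) ?_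
    intro R R' h
    obtain ⟨e⟩ := nonempty_iso_of_extClass_eq _ _ h
    apply Subtype.ext
    rw [← Quotient.out_eq R.1, ← Quotient.out_eq R'.1]
    exact Quotient.sound (s := isIsomorphicSetoid C) ⟨e⟩
  exact Set.toFinite _

/-! ### The Hall algebra and Green's coproduct -/

variable (C) in
/-- The vector space underlying the Hall algebra, with basis the isomorphism classes `[M]`. -/
abbrev HallAlgebra : Type u := IsoClass C →₀ ℂ

/-- The product `[M] · [N] = ⟨M, N⟩ₘ ∑_R (1 / (a_M a_N)) P_{M,N}^R [R]` of basis vectors. -/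
def hallBasisMul [Finitary.{w} C] (E : EulerForm.{w} C) (M N : IsoClass C) : HallAlgebra C :=
  E.form M.toK0 N.toK0 •
    Finsupp.ofSupportFinite
      (fun R => (1 / ((autCard M : ℂ) * (autCard N : ℂ))) * (hallP M N R : ℂ))
      ((finite_support_hallP.{w} M N).subset fun R hR h0 => hR (by simp [h0]))

/-- The product of the Hall algebra. -/
def hallMul [Finitary.{w} C] (E : EulerForm.{w} C) :
    HallAlgebra C →ₗ[ℂ] HallAlgebra C →ₗ[ℂ] HallAlgebra C :=
  Finsupp.linearCombination ℂ fun M => Finsupp.linearCombination ℂ fun N => hallBasisMul E M N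

variable (C) in
/-- The unit `[0]` of the Hall algebra. -/
def hallOne : HallAlgebra C := Finsupp.single (isoClass (0 : C)) 1

/-- Green's coproduct `Δ([R]) = ∑_{M,N} ⟨M, N⟩ₘ (1 / a_R) P_{M,N}^R [M] ⊗ [N]`, with values in the
space of all formal infinite linear combinations of the symbols `[M] ⊗ [N]`. -/
def hallComul (E : EulerForm.{w} C) :
    HallAlgebra C →ₗ[ℂ] (IsoClass C × IsoClass C → ℂ) :=
  Finsupp.linearCombination ℂ fun R p =>
    E.form p.1.toK0 p.2.toK0 * (1 / (autCard R : ℂ)) * (hallP p.1 p.2 R : ℂ)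

/-! ### The extended Hall algebra -/

variable (C) in
/-- The vector space underlying the extended Hall algebra `H ⊗ ℂ[K₀]`; the pair `(M, α)`
corresponds to the basis vector `[M] k_α`. -/
abbrev ExtHallAlgebra : Type u := (IsoClass C × K0 C) →₀ ℂ

/-- The product of the extended Hall algebra. The relation `k_α [N] = (α, N)ₘ [N] k_α` amounts to
`[M] k_α · [N] k_β = (α, N)ₘ ([M] · [N]) k_{α + β}`. -/
def extHallMul [Finitary.{w} C] (E : EulerForm.{w} C) :
    ExtHallAlgebra C →ₗ[ℂ] ExtHallAlgebra C →ₗ[ℂ] ExtHallAlgebra C :=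
  Finsupp.linearCombination ℂ fun x => Finsupp.linearCombination ℂ fun y =>
    E.symm x.2 y.1.toK0 • (hallBasisMul E x.1 y.1).mapDomain fun R => (R, x.2 + y.2)

variable (C) in
/-- The unit `[0] k_0` of the extended Hall algebra. -/
def extHallOne : ExtHallAlgebra C := Finsupp.single (isoClass (0 : C), 0) 1

open scoped Classical in
/-- The coproduct of the extended Hall algebra,
`Δ([R] k_α) = ∑_{M,N} ⟨M, N⟩ₘ (1 / a_R) P_{M,N}^R [M] k_{N + α} ⊗ [N] k_α`. -/
def extHallComul (E : EulerForm.{w} C) :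
    ExtHallAlgebra C →ₗ[ℂ] ((IsoClass C × K0 C) × (IsoClass C × K0 C) → ℂ) :=
  Finsupp.linearCombination ℂ fun x p =>
    if p.1.2 = p.2.1.toK0 + x.2 ∧ p.2.2 = x.2 then
      E.form p.1.1.toK0 p.2.1.toK0 * (1 / (autCard x.1 : ℂ)) * (hallP p.1.1 p.2.1 x.1 : ℂ)
    else 0

end Hall

/-! ### Multiplication in the completed tensor square

Let `A` be the vector space with basis `I`, with a product `m`. The completed tensor square of `A`
is the space `I × I → ℂ` of formal infinite linear combinations of the symbols `i ⊗ j`. Let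
`t j k` be a scalar by which the product is twisted when `j` jumps over `k`. -/

section Completion

variable {I : Type*}

/-- The coefficient of `r.1 ⊗ r.2` in the product
`(p.1 ⊗ p.2) · (q.1 ⊗ q.2) = t p.2 q.1 (p.1 q.1 ⊗ p.2 q.2)`. -/
def tensorCoeff (m : (I →₀ ℂ) →ₗ[ℂ] (I →₀ ℂ) →ₗ[ℂ] (I →₀ ℂ)) (t : I → I → ℂ)
    (p q r : I × I) : ℂ :=
  t p.2 q.1 * (m (Finsupp.single p.1 1) (Finsupp.single q.1 1) r.1 *
    m (Finsupp.single p.2 1) (Finsupp.single q.2 1) r.2)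

/-- The product of `F` and `G` is convergent: each coefficient of the product receives only
finitely many nonzero contributions. -/
def Convergent (m : (I →₀ ℂ) →ₗ[ℂ] (I →₀ ℂ) →ₗ[ℂ] (I →₀ ℂ)) (t : I → I → ℂ)
    (F G : I × I → ℂ) : Prop :=
  ∀ r : I × I,
    {x : (I × I) × (I × I) | F x.1 * G x.2 * tensorCoeff m t x.1 x.2 r ≠ 0}.Finite

/-- The product of `F` and `G` (meaningful when it is convergent). -/
def completedMul (m : (I →₀ ℂ) →ₗ[ℂ] (I →₀ ℂ) →ₗ[ℂ] (I →₀ ℂ)) (t : I → I → ℂ)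
    (F G : I × I → ℂ) : I × I → ℂ :=
  fun r => ∑ᶠ x : (I × I) × (I × I), F x.1 * G x.2 * tensorCoeff m t x.1 x.2 r

/-- The element `x ⊗ y` of the completed tensor square. -/
def pureTensor (x y : I →₀ ℂ) : I × I → ℂ := fun r => x r.1 * y r.2

end Completion

end

end HallAlg

/-! On basis vectors, comparing the coefficients of `[P] ⊗ [Q]` in `Δ([M][N])` and `Δ([M])Δ([N])`
reduces the theorem to Green's formula (`green_formula`): the sum over `R` of `P_{M,N}^R P_{P,Q}^R /
a_R` equals the sum over edges `A, B, G, D` of `P_{A,B}^M P_{G,D}^N P_{A,G}^P P_{B,D}^Q / (a_A a_B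
a_G a_D)` times `#Ext¹(A, D) / #Hom(A, D)`.

Green's formula is a double count of pairs consisting of a cross (two short exact sequences through
`R`) and a frame (the four outer sequences of the 3×3 diagram) that are compatible. A cross
determines its frame up to automorphisms of the edges: `D`, `G`, `A` are the kernel, image and
cokernel of `N ⟶ R ⟶ P`, and `B` is the image of `Q ⟶ R ⟶ M` (`exists_frame`, `card_compat`).

Conversely, fix a frame and let `T` be the pullback of `M` and `P` over `A`. A compatible cross is
an extension of `T` by `D` whose restrictions to the subobjects `G` and `B` of `T` are the given
extensions, together with lifts of `N` and `Q`. The lifts contribute `#Hom(G, D) #Hom(B, D)`, and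
Riedtmann's formula (`finsum_card_extCls_mem`) turns the weighted count of extensions into a count
of classes in `Ext¹(T, D)` divided by `#Hom(T, D)`. Since `Ext²` vanishes, `Ext¹(T, D) ⟶ Ext¹(G, D)
× Ext¹(B, D)` is surjective, so its fibres all have the same size. As `T` has class `A + B + G`,
additivity of the Euler form leaves `#Ext¹(A, D) / #Hom(A, D)` (`finsum_card_isCompatible`).

This factor is `⟨A, D⟩ₘ⁻²`, exactly the discrepancy between the Euler twists on the two sides.
Convergence holds because the edges of a frame are determined up to isomorphism by two morphisms `N
⟶ P` and `Q ⟶ M`, which range over finite sets. In the extended algebra the labels `k_α` produce the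
twist `(B, G)ₘ` that was imposed by hand on tensors. -/

namespace HallAlg

/-! ### Realization of classes in `Ext¹` by short exact sequences -/

section Realization

open DerivedCategory Pretriangulated

variable {C : Type u} [Category.{v} C] [Abelian C]

/-- A distinguished triangle in the derived category with vertices in degree zero comes from a
short exact sequence. -/
theorem shortExact_of_distinguished [HasDerivedCategory.{w} C] {D R T : C} (j : D ⟶ R) (p : R ⟶ T)
    (δ : (singleFunctor C 0).obj T ⟶ ((singleFunctor C 0).obj D)⟦(1 : ℤ)⟧)
    (hT : Triangle.mk ((singleFunctor C 0).map j) ((singleFunctor C 0).map p) δ ∈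
      distTriang (DerivedCategory C)) :
    ∃ h : j ≫ p = 0, (ShortComplex.mk j p h).ShortExact := by
  have h : j ≫ p = 0 := by
    apply (singleFunctor C 0).map_injective
    rw [Functor.map_comp, Functor.map_zero]
    exact comp_distTriang_mor_zero₁₂ _ hT
  -- By the t-structure there are no nonzero morphisms `D[1] ⟶ Y` or `X ⟶ T[-1]` for objects `X`,
  -- `Y` in degree zero. These would be the obstructions to `p` being epi and `j` being mono.
  have hD : (((singleFunctor C 0).obj D)⟦(1 : ℤ)⟧).IsLE (-1) :=
    TStructure.t.isLE_shift _ 0 1 (-1) (by lia)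
  have hT' : (((singleFunctor C 0).obj T)⟦(-1 : ℤ)⟧).IsGE 1 :=
    TStructure.t.isGE_shift _ 0 (-1) 1 (by lia)
  refine ⟨h, ?_⟩
  have hj : Mono j := by
    refine Preadditive.mono_of_cancel_zero _ fun {X} x hx => ?_
    apply (singleFunctor C 0).map_injective
    obtain ⟨g, hg⟩ := Triangle.coyoneda_exact₂ _ (inv_rot_of_distTriang _ hT)
      ((singleFunctor C 0).map x) (by
        change (singleFunctor C 0).map x ≫ (singleFunctor C 0).map j = 0
        rw [← Functor.map_comp, hx, Functor.map_zero])
    have hg0 : g = 0 := TStructure.t.zero_of_isLE_of_isGE g 0 1 (by lia) inferInstance hT'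
    rw [hg, hg0, Limits.zero_comp, Functor.map_zero]
    rfl
  have hp : Epi p := by
    refine Preadditive.epi_of_cancel_zero _ fun {Y} y hy => ?_
    apply (singleFunctor C 0).map_injective
    obtain ⟨g, hg⟩ := Triangle.yoneda_exact₃ _ hT ((singleFunctor C 0).map y) (by
        change (singleFunctor C 0).map p ≫ (singleFunctor C 0).map y = 0
        rw [← Functor.map_comp, hy, Functor.map_zero])
    have hg0 : g = 0 := TStructure.t.zero_of_isLE_of_isGE g (-1) 0 (by lia) hD inferInstance
    rw [hg, hg0, Limits.comp_zero, Functor.map_zero]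
    rfl
  refine { exact := ?_, mono_f := hj, epi_g := hp }
  rw [ShortComplex.exact_iff_exact_up_to_refinements]
  intro X x hx
  obtain ⟨g, hg⟩ := Triangle.coyoneda_exact₂ _ hT ((singleFunctor C 0).map x) (by
    change (singleFunctor C 0).map x ≫ (singleFunctor C 0).map p = 0
    rw [← Functor.map_comp]
    dsimp at hx
    rw [hx, Functor.map_zero])
  obtain ⟨g, rfl⟩ := (singleFunctor C 0).map_surjective g
  refine ⟨X, 𝟙 X, inferInstance, g, (singleFunctor C 0).map_injective ?_⟩
  rw [Category.id_comp, Functor.map_comp]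
  exact hg

/-- Every class in `Ext¹` is the class of a short exact sequence. -/
theorem exists_extClass_eq [HasExt.{w} C] {T D : C} (e : Ext.{w} T D 1) :
    ∃ (R : C) (j : D ⟶ R) (p : R ⟶ T) (h : j ≫ p = 0)
      (hS : (ShortComplex.mk j p h).ShortExact), hS.extClass = e := by
  let := HasDerivedCategory.standard C
  let δ : (singleFunctor C 0).obj T ⟶ ((singleFunctor C 0).obj D)⟦(1 : ℤ)⟧ := e.hom
  obtain ⟨R', j', p', hT⟩ := distinguished_cocone_triangle₂ δ
  -- The middle vertex is an extension of objects of the heart, hence lies in the heart.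
  have hLE : R'.IsLE 0 := TStructure.t.isLE₂ _ hT 0
    (inferInstanceAs (((singleFunctor C 0).obj D).IsLE 0))
    (inferInstanceAs (((singleFunctor C 0).obj T).IsLE 0))
  have hGE : R'.IsGE 0 := TStructure.t.isGE₂ _ hT 0
    (inferInstanceAs (((singleFunctor C 0).obj D).IsGE 0))
    (inferInstanceAs (((singleFunctor C 0).obj T).IsGE 0))
  obtain ⟨R, ⟨i⟩⟩ := exists_iso_singleFunctor_obj_of_isGE_of_isLE R' 0
  obtain ⟨j, hj⟩ := (singleFunctor C 0).map_surjective (j' ≫ i.hom)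
  obtain ⟨p, hp⟩ := (singleFunctor C 0).map_surjective (i.inv ≫ p')
  have hT₂ : Triangle.mk ((singleFunctor C 0).map j) ((singleFunctor C 0).map p) δ ∈
      distTriang (DerivedCategory C) := by
    refine isomorphic_distinguished _ hT _ (Triangle.isoMk _ _ (Iso.refl _) i.symm (Iso.refl _)
      ?_ ?_ ?_)
    · change (singleFunctor C 0).map j ≫ i.inv = 𝟙 ((singleFunctor C 0).obj D) ≫ j'
      simp [hj]
    · change (singleFunctor C 0).map p ≫ 𝟙 ((singleFunctor C 0).obj T) = i.inv ≫ p'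
      simp [hp]
    · change δ ≫ (𝟙 ((singleFunctor C 0).obj D))⟦(1 : ℤ)⟧' = 𝟙 ((singleFunctor C 0).obj T) ≫ δ
      simp
  obtain ⟨h, hS⟩ := shortExact_of_distinguished j p δ hT₂
  refine ⟨R, j, p, h, hS, ?_⟩
  -- The two triangles share their first two morphisms. The comparison on the third vertex is
  -- compatible with the epimorphism `p`, hence is the identity, and so the connecting morphisms
  -- agree.
  obtain ⟨c, hc₁, hc₂⟩ := complete_distinguished_triangle_morphism _ _
    hS.singleTriangle_distinguished hT₂ (𝟙 _) (𝟙 _)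
    ((Category.comp_id _).trans (Category.id_comp _).symm)
  obtain ⟨c, rfl⟩ := (singleFunctor C 0).map_surjective c
  have hc : c = 𝟙 T := by
    have := hS.epi_g
    dsimp at this
    rw [← cancel_epi p]
    apply (singleFunctor C 0).map_injective
    rw [Functor.map_comp, Category.comp_id]
    exact hc₁.trans (Category.id_comp _)
  subst hc
  ext
  rw [ShortComplex.ShortExact.extClass_hom]
  change hS.singleδ ≫ (𝟙 ((singleFunctor C 0).obj D))⟦(1 : ℤ)⟧' =
    (singleFunctor C 0).map (𝟙 T) ≫ δ at hc₂
  rwa [CategoryTheory.Functor.map_id, CategoryTheory.Functor.map_id, Category.comp_id, Category.id_comp] at hc₂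

end Realization

/-! ### Morphisms of extensions and their classes -/

section Lifts

variable {C : Type u} [Category.{v} C] [Abelian C]

variable {D R T N G : C}

theorem exactSeqs_comp {x : (D ⟶ R) × (R ⟶ T)} (hx : x ∈ exactSeqs T D R) : x.1 ≫ x.2 = 0 :=
  hx.choose

theorem exactSeqs_mono {x : (D ⟶ R) × (R ⟶ T)} (hx : x ∈ exactSeqs T D R) : Mono x.1 :=
  hx.choose_spec.mono_f

theorem exactSeqs_epi {x : (D ⟶ R) × (R ⟶ T)} (hx : x ∈ exactSeqs T D R) : Epi x.2 :=
  hx.choose_spec.epi_g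

theorem exactSeqs_exists_lift {x : (D ⟶ R) × (R ⟶ T)} (hx : x ∈ exactSeqs T D R) {Z : C}
    (k : Z ⟶ R) (hk : k ≫ x.2 = 0) : ∃ l : Z ⟶ D, l ≫ x.1 = k :=
  have := exactSeqs_mono hx
  ⟨hx.choose_spec.exact.lift k hk, hx.choose_spec.exact.lift_f k hk⟩

theorem exactSeqs_exists_desc {x : (D ⟶ R) × (R ⟶ T)} (hx : x ∈ exactSeqs T D R) {Z : C}
    (k : R ⟶ Z) (hk : x.1 ≫ k = 0) : ∃ l : T ⟶ Z, x.2 ≫ l = k :=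
  have := exactSeqs_epi hx
  ⟨hx.choose_spec.exact.desc k hk, hx.choose_spec.exact.g_desc k hk⟩

/-- A short exact sequence is a monomorphism, an epimorphism, and lifts along the former of the
morphisms killed by the latter. -/
theorem mem_exactSeqs_of_lift {x : (D ⟶ R) × (R ⟶ T)} (h : x.1 ≫ x.2 = 0) (h₁ : Mono x.1)
    (h₂ : Epi x.2) (hl : ∀ {Z : C} (k : Z ⟶ R), k ≫ x.2 = 0 → ∃ l : Z ⟶ D, l ≫ x.1 = k) :
    x ∈ exactSeqs T D R := by
  refine ⟨h, { exact := ?_, mono_f := h₁, epi_g := h₂ }⟩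
  rw [ShortComplex.exact_iff_exact_up_to_refinements]
  intro Z k hk
  obtain ⟨l, hl⟩ := hl k hk
  exact ⟨Z, 𝟙 Z, inferInstance, l, by simpa using hl.symm⟩

variable (D R T) in
/-- The extensions of the identity of `D` and of the morphism `u` to a morphism from the extension
`y` to the extension `x`. -/
def middleMaps (x : (D ⟶ R) × (R ⟶ T)) (y : (D ⟶ N) × (N ⟶ G)) (u : G ⟶ T) : Set (N ⟶ R) :=
  {a | y.1 ≫ a = x.1 ∧ a ≫ x.2 = y.2 ≫ u}

/-- Two middle maps differ by a morphism that vanishes on `D` and becomes zero in `T`, so it factors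
uniquely as `N ⟶ G ⟶ D ⟶ R`: a nonempty set of middle maps is a torsor under `Hom(G, D)`. -/
theorem nonempty_middleMaps_equiv {x : (D ⟶ R) × (R ⟶ T)} (hx : x ∈ exactSeqs T D R)
    {y : (D ⟶ N) × (N ⟶ G)} (hy : y ∈ exactSeqs G D N) {u : G ⟶ T}
    (h : (middleMaps D R T x y u).Nonempty) :
    Nonempty ((G ⟶ D) ≃ middleMaps D R T x y u) := by
  obtain ⟨a, ha₁, ha₂⟩ := h
  have := exactSeqs_mono hx
  have := exactSeqs_epi hy
  refine ⟨Equiv.ofBijective (fun s => ⟨a + y.2 ≫ s ≫ x.1, ?_, ?_⟩) ⟨?_, ?_⟩⟩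
  · simp [ha₁, reassoc_of% exactSeqs_comp hy]
  · simp [ha₂, exactSeqs_comp hx]
  · intro s t hst
    have h := congrArg Subtype.val hst
    simpa [cancel_epi, ← Category.assoc, cancel_mono] using h
  · rintro ⟨b, hb₁, hb₂⟩
    obtain ⟨k, hk⟩ := exactSeqs_exists_desc hy (b - a) (by simp [ha₁, hb₁])
    obtain ⟨l, hl⟩ := exactSeqs_exists_lift hx k (by
      rw [← cancel_epi y.2, reassoc_of% hk]
      simp [ha₂, hb₂])
    exact ⟨l, Subtype.ext (by simp [hl, hk])⟩

theorem isIso_of_mem_middleMaps {S : C} {x : exactSeqs T D R} {y : exactSeqs T D S} {a : S ⟶ R}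
    (ha : a ∈ middleMaps D R T x.1 y.1 (𝟙 T)) : IsIso a := by
  let φ : ShortComplex.mk y.1.1 y.1.2 (exactSeqs_comp y.2) ⟶
      ShortComplex.mk x.1.1 x.1.2 (exactSeqs_comp x.2) :=
    { τ₁ := 𝟙 D, τ₂ := a, τ₃ := 𝟙 T, comm₁₂ := by simp [ha.1], comm₂₃ := by simp [ha.2] }
  have : IsIso φ.τ₁ := by dsimp [φ]; infer_instance
  have : IsIso φ.τ₃ := by dsimp [φ]; infer_instance
  exact ShortComplex.isIso₂_of_shortExact_of_isIso₁₃ φ y.2.choose_spec x.2.choose_spec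

variable [HasExt.{w} C]

/-- The class in `Ext¹` of a short exact sequence. -/
noncomputable def extCls (x : exactSeqs T D R) : Ext.{w} T D 1 := x.2.choose_spec.extClass

theorem exists_cls_eq (e : Ext.{w} T D 1) : ∃ (R : C) (x : exactSeqs T D R), extCls.{w} x = e := by
  obtain ⟨R, j, p, h, hS, rfl⟩ := exists_extClass_eq e
  exact ⟨R, ⟨(j, p), h, hS⟩, rfl⟩

/-- One direction is naturality of the extension class. For the other, the long exact sequences
first extend `D ⟶ R` along `D ⟶ N`, inducing some `v : G ⟶ T`. Then `v - u` annihilates the class of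
`x`, so it lifts to `R`, and subtracting this lift replaces `v` by `u`. -/
theorem middleMaps_nonempty_iff (x : exactSeqs T D R) (y : exactSeqs G D N) (u : G ⟶ T) :
    (middleMaps D R T x.1 y.1 u).Nonempty ↔
      (Ext.mk₀ u).comp (extCls.{w} x) (zero_add 1) = extCls.{w} y := by
  have nat : ∀ (v : G ⟶ T) (a : N ⟶ R), y.1.1 ≫ a = x.1.1 → a ≫ x.1.2 = y.1.2 ≫ v →
      (Ext.mk₀ v).comp (extCls.{w} x) (zero_add 1) = extCls.{w} y := by
    intro v a ha₁ ha₂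
    let φ : ShortComplex.mk y.1.1 y.1.2 (exactSeqs_comp y.2) ⟶
        ShortComplex.mk x.1.1 x.1.2 (exactSeqs_comp x.2) :=
      { τ₁ := 𝟙 D, τ₂ := a, τ₃ := v, comm₁₂ := by simp [ha₁], comm₂₃ := by simp [ha₂] }
    have hn := ShortComplex.ShortExact.extClass_naturality.{w} y.2.choose_spec x.2.choose_spec φ
    simpa [φ, extCls] using hn.symm
  constructor
  · rintro ⟨a, ha₁, ha₂⟩
    exact nat u a ha₁ ha₂
  · intro hu
    have := exactSeqs_epi y.2
    obtain ⟨b, hb⟩ := Ext.contravariant_sequence_exact₁ y.2.choose_spec R (Ext.mk₀ x.1.1)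
      (add_zero 1) (by
        change (extCls.{w} y).comp _ _ = 0
        rw [← hu, Ext.comp_assoc_of_third_deg_zero]
        change (Ext.mk₀ u).comp (x.2.choose_spec.extClass.comp _ _) _ = 0
        rw [x.2.choose_spec.extClass_comp, Ext.comp_zero])
    obtain ⟨b, rfl⟩ := Ext.homEquiv₀.symm.surjective b
    have hb₁ : y.1.1 ≫ b = x.1.1 := by
      apply Ext.homEquiv₀.symm.injective
      simpa using hb
    obtain ⟨v, hv⟩ := exactSeqs_exists_desc y.2 (b ≫ x.1.2) (by
      rw [reassoc_of% hb₁, exactSeqs_comp x.2])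
    have hv' := nat v b hb₁ hv.symm
    obtain ⟨s, hs⟩ := Ext.covariant_sequence_exact₃ G x.2.choose_spec (Ext.mk₀ (v - u))
      (zero_add 1) (by
        change (Ext.mk₀ (v - u)).comp (extCls.{w} x) _ = 0
        rw [sub_eq_add_neg, Ext.mk₀_add, Ext.add_comp, hv', Ext.mk₀_neg, Ext.neg_comp, hu]
        exact add_neg_cancel _)
    obtain ⟨s, rfl⟩ := Ext.homEquiv₀.symm.surjective s
    have hs' : s ≫ x.1.2 = v - u := by
      apply Ext.homEquiv₀.symm.injective
      simpa using hs
    refine ⟨b - y.1.2 ≫ s, ?_, ?_⟩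
    · simp [hb₁, reassoc_of% exactSeqs_comp y.2]
    · simp [hs', ← hv]

/-- The isomorphisms between the middle terms of extensions, grouped by the image of a fixed
extension with class `e`. -/
theorem card_iso_eq [∀ X Y : C, Finite (X ⟶ Y)] {S : C} (y : exactSeqs T D S) (R : C) :
    Nat.card (S ≅ R) =
      Nat.card {x : exactSeqs T D R // extCls.{w} x = extCls.{w} y} * Nat.card (T ⟶ D) := by
  have e : ∀ x : {x : exactSeqs T D R // extCls.{w} x = extCls.{w} y},
      Nonempty (middleMaps D R T x.1.1 y.1 (𝟙 T) ≃ (T ⟶ D)) := fun x => by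
    obtain ⟨e⟩ := nonempty_middleMaps_equiv x.1.2 y.2 ((middleMaps_nonempty_iff.{w} _ _ _).2
      (by rw [x.2, Ext.mk₀_id_comp]))
    exact ⟨e.symm⟩
  rw [← Nat.card_prod]
  refine Nat.card_congr (Equiv.trans ?_ ((Equiv.sigmaCongrRight fun x => (e x).some).trans
    (Equiv.sigmaEquivProd _ _)))
  have hmem : ∀ φ : S ≅ R, (y.1.1 ≫ φ.hom, φ.inv ≫ y.1.2) ∈ exactSeqs T D R := fun φ => by
    simpa using exactSeqs_of_iso (Iso.refl T) (Iso.refl D) φ y.2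
  have hcls : ∀ φ : S ≅ R, extCls.{w} (⟨_, hmem φ⟩ : exactSeqs T D R) = extCls.{w} y :=
    fun φ => by
      have := (middleMaps_nonempty_iff.{w} ⟨_, hmem φ⟩ y (𝟙 T)).1 ⟨φ.hom, by simp [middleMaps]⟩
      rwa [Ext.mk₀_id_comp] at this
  -- An isomorphism is recorded as the extension transported from `y` along it, with itself as the
  -- middle map over identities. Conversely, such a middle map is invertible and determines the
  -- transported extension.
  refine
    { toFun := fun φ => ⟨⟨⟨_, hmem φ⟩, hcls φ⟩, φ.hom, by simp [middleMaps]⟩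
      invFun := fun z => have := isIso_of_mem_middleMaps z.2.2; asIso z.2.1
      left_inv := fun φ => by ext; simp
      right_inv := ?_ }
  rintro ⟨⟨⟨⟨j, p⟩, hx⟩, hc⟩, a, ha⟩
  have := isIso_of_mem_middleMaps ha
  obtain ⟨h₁, h₂⟩ := ha
  dsimp at h₁ h₂
  obtain rfl : j = y.1.1 ≫ a := h₁.symm
  obtain rfl : p = inv a ≫ y.1.2 := by
    rw [IsIso.eq_inv_comp, h₂, Category.comp_id]
  simp

end Lifts

/-! ### Crosses with a given frame as extensions of a pullback -/

section Crosses

variable {C : Type u} [Category.{v} C] [Abelian C] {A B G D M N P Q R T : C}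

/-- The short exact sequences `x₁`, `x₂`, `x₃`, `x₄` (a frame) and the two short exact
sequences `y₁ : N ⟶ R ⟶ M` and `y₂ : Q ⟶ R ⟶ P` form a commutative diagram
```
D ⟶ Q ⟶ B
↓    ↓    ↓
N ⟶ R ⟶ M
↓    ↓    ↓
G ⟶ P ⟶ A
```
whose sides are the frame. -/
structure IsCompatible (x₁ : (B ⟶ M) × (M ⟶ A)) (x₂ : (D ⟶ N) × (N ⟶ G))
    (x₃ : (G ⟶ P) × (P ⟶ A)) (x₄ : (D ⟶ Q) × (Q ⟶ B)) (y₁ : (N ⟶ R) × (R ⟶ M))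
    (y₂ : (Q ⟶ R) × (R ⟶ P)) : Prop where
  upper_left : x₂.1 ≫ y₁.1 = x₄.1 ≫ y₂.1
  lower_left : y₁.1 ≫ y₂.2 = x₂.2 ≫ x₃.1
  upper_right : y₂.1 ≫ y₁.2 = x₄.2 ≫ x₁.1
  lower_right : y₁.2 ≫ x₁.2 = y₂.2 ≫ x₃.2

variable {x₁ : (B ⟶ M) × (M ⟶ A)} {x₂ : (D ⟶ N) × (N ⟶ G)} {x₃ : (G ⟶ P) × (P ⟶ A)}
  {x₄ : (D ⟶ Q) × (Q ⟶ B)}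

/-- The base change of the epimorphism `P ⟶ A` along `M ⟶ A` is an epimorphism with the same kernel
`G`. -/
theorem mem_exactSeqs_of_isPullback (hx₃ : x₃ ∈ exactSeqs A G P) {t₁ : T ⟶ M}
    {t₃ : T ⟶ P} (sq : IsPullback t₁ t₃ x₁.2 x₃.2) {u : G ⟶ T} (hu₁ : u ≫ t₁ = 0)
    (hu₃ : u ≫ t₃ = x₃.1) : (u, t₁) ∈ exactSeqs M G T := by
  have := exactSeqs_epi hx₃
  have := exactSeqs_mono hx₃
  refine mem_exactSeqs_of_lift hu₁ ?_ (Abelian.epi_fst_of_isLimit _ _ sq.isLimit) ?_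
  · have : Mono (u ≫ t₃) := hu₃ ▸ this
    exact mono_of_mono u t₃
  · intro Z k hk
    dsimp at hk
    obtain ⟨l, hl⟩ := exactSeqs_exists_lift hx₃ (k ≫ t₃) (by
      rw [Category.assoc, ← sq.w, reassoc_of% hk, Limits.zero_comp])
    exact ⟨l, sq.hom_ext (by simp [hu₁, hk]) (by simp [hu₃, hl])⟩

/-- By the snake lemma, a morphism of extensions that is the identity on `D` and `u` on the
quotients is mono in the middle, with the same cokernel `M` as `u`. -/
theorem mem_exactSeqs_of_mem_middleMaps {z : (D ⟶ R) × (R ⟶ T)} (hz : z ∈ exactSeqs T D R)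
    (hx₂ : x₂ ∈ exactSeqs G D N) {u : G ⟶ T} {t : T ⟶ M} (hu : (u, t) ∈ exactSeqs M G T)
    {a : N ⟶ R} (ha : a ∈ middleMaps D R T z x₂ u) : (a, z.2 ≫ t) ∈ exactSeqs M N R := by
  obtain ⟨ha₁, ha₂⟩ := ha
  have := exactSeqs_mono hz
  have := exactSeqs_epi hz
  have := exactSeqs_epi hx₂
  have := exactSeqs_mono hu
  have := exactSeqs_epi hu
  dsimp at this
  have hut : u ≫ t = 0 := exactSeqs_comp hu
  have h : a ≫ z.2 ≫ t = 0 := by rw [reassoc_of% ha₂, hut, Limits.comp_zero]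
  refine ⟨h, { exact := ?_, mono_f := ?_, epi_g := epi_comp _ _ }⟩
  · rw [ShortComplex.exact_iff_exact_up_to_refinements]
    intro Z k hk
    dsimp at hk
    obtain ⟨l, hl⟩ := exactSeqs_exists_lift hu (k ≫ z.2) (by simpa using hk)
    obtain ⟨Z', π, hπ, n, hn⟩ := surjective_up_to_refinements_of_epi x₂.2 l
    obtain ⟨d, hd⟩ := exactSeqs_exists_lift hz (π ≫ k - n ≫ a) (by
      dsimp at hl
      simp [ha₂, ← hl, reassoc_of% hn])
    refine ⟨Z', π, hπ, d ≫ x₂.1 + n, ?_⟩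
    simp [ha₁, hd]
  · refine Preadditive.mono_of_cancel_zero _ fun {Z} k hk => ?_
    dsimp at hk
    have h₁ : k ≫ x₂.2 = 0 := by
      rw [← cancel_mono u, Category.assoc, ← ha₂, reassoc_of% hk, Limits.zero_comp,
        Limits.zero_comp]
    obtain ⟨l, rfl⟩ := exactSeqs_exists_lift hx₂ k h₁
    rw [Category.assoc, ha₁] at hk
    rw [Limits.zero_of_comp_mono z.1 hk, Limits.zero_comp]

/-- The glued map `R ⟶ T` is epi by the four lemma, comparing `N ⟶ R ⟶ M` with `G ⟶ T ⟶ M`. What it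
kills dies in `M`, hence comes from `N`; it also dies in `P`, hence in `G`, so it comes from `D`. -/
theorem mem_exactSeqs_lift {y₁ : (N ⟶ R) × (R ⟶ M)} {y₂ : (Q ⟶ R) × (R ⟶ P)}
    (hx₂ : x₂ ∈ exactSeqs G D N) (hx₃ : x₃ ∈ exactSeqs A G P)
    (hy₁ : y₁ ∈ exactSeqs M N R) (hl : y₁.1 ≫ y₂.2 = x₂.2 ≫ x₃.1) {t₁ : T ⟶ M} {t₃ : T ⟶ P}
    (sq : IsPullback t₁ t₃ x₁.2 x₃.2) {u : G ⟶ T} (hu₁ : u ≫ t₁ = 0) (hu₃ : u ≫ t₃ = x₃.1)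
    {p : R ⟶ T} (hp₁ : p ≫ t₁ = y₁.2) (hp₃ : p ≫ t₃ = y₂.2) :
    (x₂.1 ≫ y₁.1, p) ∈ exactSeqs T D R := by
  have hu := mem_exactSeqs_of_isPullback hx₃ sq hu₁ hu₃
  have := exactSeqs_mono hx₂
  have := exactSeqs_mono hx₃
  have := exactSeqs_mono hy₁
  refine mem_exactSeqs_of_lift (sq.hom_ext ?_ ?_) (mono_comp _ _) ?_ ?_
  · simp [hp₁, exactSeqs_comp hy₁]
  · simp [hp₃, hl, reassoc_of% exactSeqs_comp hx₂]
  · let φ : ShortComplex.mk y₁.1 y₁.2 (exactSeqs_comp hy₁) ⟶ ShortComplex.mk u t₁ hu₁ :=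
      { τ₁ := x₂.2, τ₂ := p, τ₃ := 𝟙 M
        comm₁₂ := sq.hom_ext (by simp [hp₁, hu₁, exactSeqs_comp hy₁]) (by simp [hp₃, hu₃, hl])
        comm₂₃ := by simp [hp₁] }
    exact ShortComplex.epi_of_epi_of_epi_of_epi φ hu.choose_spec.exact (exactSeqs_epi hy₁)
      (exactSeqs_epi hx₂) (by dsimp [φ]; infer_instance)
  · intro Z k hk
    dsimp at hk
    obtain ⟨l, rfl⟩ := exactSeqs_exists_lift hy₁ k (by rw [← hp₁, reassoc_of% hk, Limits.zero_comp])
    obtain ⟨m, rfl⟩ := exactSeqs_exists_lift hx₂ l (by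
      rw [← cancel_mono x₃.1, Category.assoc, ← hl, ← hp₃, ← Category.assoc, ← Category.assoc, hk,
        Limits.zero_comp, Limits.zero_comp])
    exact ⟨m, by simp⟩

/-- The crosses compatible with a frame correspond to the extensions of the pullback of the lower
right corner by the upper left object, together with lifts of the two subobjects. -/
theorem nonempty_isCompatible_equiv (hx₁ : x₁ ∈ exactSeqs A B M) (hx₂ : x₂ ∈ exactSeqs G D N)
    (hx₃ : x₃ ∈ exactSeqs A G P) (hx₄ : x₄ ∈ exactSeqs B D Q) {t₁ : T ⟶ M} {t₃ : T ⟶ P}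
    (sq : IsPullback t₁ t₃ x₁.2 x₃.2) {u : G ⟶ T} (hu₁ : u ≫ t₁ = 0) (hu₃ : u ≫ t₃ = x₃.1)
    {v : B ⟶ T} (hv₁ : v ≫ t₁ = x₁.1) (hv₃ : v ≫ t₃ = 0) (R : C) :
    Nonempty ({y : exactSeqs M N R × exactSeqs P Q R // IsCompatible x₁ x₂ x₃ x₄ y.1.1 y.2.1} ≃
      Σ z : exactSeqs T D R, middleMaps D R T z.1 x₂ u × middleMaps D R T z.1 x₄ v) := by
  refine ⟨?_⟩
  have hu := mem_exactSeqs_of_isPullback hx₃ sq hu₁ hu₃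
  have hv := mem_exactSeqs_of_isPullback hx₁ sq.flip hv₃ hv₁
  -- A cross yields the extension whose quotient map is glued from `R ⟶ M` and `R ⟶ P`, with `N ⟶ R`
  -- and `Q ⟶ R` as middle maps. Composing with the projections of `T` recovers the cross.
  exact
    { toFun := fun y => ⟨⟨(x₂.1 ≫ y.1.1.1.1, sq.lift _ _ y.2.lower_right),
          mem_exactSeqs_lift hx₂ hx₃ y.1.1.2 y.2.lower_left sq hu₁ hu₃
            (sq.lift_fst _ _ _) (sq.lift_snd _ _ _)⟩,
        ⟨y.1.1.1.1, rfl, sq.hom_ext (by simp [hu₁, exactSeqs_comp y.1.1.2])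
          (by simp [hu₃, y.2.lower_left])⟩,
        ⟨y.1.2.1.1, y.2.upper_left.symm, sq.hom_ext (by simp [hv₁, y.2.upper_right])
          (by simp [hv₃, exactSeqs_comp y.1.2.2])⟩⟩
      invFun := fun s => ⟨(⟨(s.2.1.1, s.1.1.2 ≫ t₁),
          mem_exactSeqs_of_mem_middleMaps s.1.2 hx₂ hu s.2.1.2⟩,
        ⟨(s.2.2.1, s.1.1.2 ≫ t₃), mem_exactSeqs_of_mem_middleMaps s.1.2 hx₄ hv s.2.2.2⟩),
        { upper_left := s.2.1.2.1.trans s.2.2.2.1.symm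
          lower_left := by
            dsimp
            rw [← Category.assoc, s.2.1.2.2, Category.assoc, hu₃]
          upper_right := by
            dsimp
            rw [← Category.assoc, s.2.2.2.2, Category.assoc, hv₁]
          lower_right := by simp [sq.w] }⟩
      left_inv := fun y => by ext <;> simp
      right_inv := by
        rintro ⟨⟨⟨j, p⟩, hz⟩, ⟨a, ha₁, ha₂⟩, ⟨b, hb₁, hb₂⟩⟩
        dsimp at ha₁
        subst ha₁
        -- The reglued quotient map equals `p` only propositionally; generalizing it to `q` replaces
        -- it in all dependent components at once.
        have key : ∀ q (_ : q = p) h₁ h₂ h₃,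
            (⟨⟨(x₂.1 ≫ a, q), h₁⟩, ⟨a, rfl, h₂⟩, ⟨b, hb₁, h₃⟩⟩ :
              Σ z : exactSeqs T D R, middleMaps D R T z.1 x₂ u × middleMaps D R T z.1 x₄ v) =
            ⟨⟨(x₂.1 ≫ a, p), hz⟩, ⟨a, rfl, ha₂⟩, ⟨b, hb₁, hb₂⟩⟩ := by
          rintro _ rfl _ _ _
          rfl
        have e : sq.lift (p ≫ t₁) (p ≫ t₃) (by simp [sq.w]) = p :=
          sq.hom_ext (by simp) (by simp)
        exact key _ e (e.symm ▸ hz) (by dsimp only; rw [e]; exact ha₂)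
          (by dsimp only; rw [e]; exact hb₂) }

end Crosses

/-! ### Weighted count of the crosses with a given frame -/

section Counting

theorem card_fiber_mul_card {A B : Type*} [AddCommGroup A] [AddCommGroup B] [Finite A]
    (f : A →+ B) (hf : Function.Surjective f) (b : B) :
    Nat.card {a // f a = b} * Nat.card B = Nat.card A := by
  have e : Nat.card {a // f a = b} = Nat.card f.ker :=
    Nat.card_congr (AddMonoidHom.fiberEquivKerOfSurjective hf b)
  rw [e, AddSubgroup.card_eq_card_quotient_mul_card_addSubgroup f.ker,
    Nat.card_congr (QuotientAddGroup.quotientKerEquivOfSurjective f hf).toEquiv, mul_comm]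

variable {C : Type u} [Category.{v} C]

theorem autCard_ne_zero [∀ X Y : C, Finite (X ⟶ Y)] (M : IsoClass C) : (autCard M : ℂ) ≠ 0 := by
  have : Finite (Aut M.out) :=
    Finite.of_injective (fun φ : Aut M.out => φ.hom) fun _ _ h => Iso.ext h
  exact_mod_cast Nat.card_pos.ne'

theorem card_iso_out_isoClass (S : C) :
    Nat.card (S ≅ (isoClass S).out) = autCard (isoClass S) :=
  Nat.card_congr (Iso.isoCongrLeft (out_iso S).some.symm)

theorem card_iso_out_of_ne {S : C} {R : IsoClass C} (h : R ≠ isoClass S) :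
    Nat.card (S ≅ R.out) = 0 := by
  have : IsEmpty (S ≅ R.out) := ⟨fun e => h (by
    rw [← Quotient.out_eq R]
    exact Quotient.sound (s := isIsomorphicSetoid C) ⟨e.symm⟩)⟩
  exact Nat.card_of_isEmpty

theorem hasFiniteSupport_card_iso (S : C) (f : ℕ → IsoClass C → ℂ) (hf : ∀ R, f 0 R = 0) :
    (fun R : IsoClass C => f (Nat.card (S ≅ R.out)) R).HasFiniteSupport :=
  (Set.finite_singleton (isoClass S)).subset fun R hR => by
    by_contra h
    exact hR (by simp only [card_iso_out_of_ne h, hf])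

theorem finsum_card_iso [∀ X Y : C, Finite (X ⟶ Y)] (S : C) :
    ∑ᶠ R : IsoClass C, (Nat.card (S ≅ R.out) : ℂ) / autCard R = 1 := by
  rw [finsum_eq_single _ (isoClass S)]
  · rw [card_iso_out_isoClass, div_self (autCard_ne_zero _)]
  · intro R hR
    rw [card_iso_out_of_ne hR, Nat.cast_zero, zero_div]

variable [Abelian C] [HasExt.{w} C]

/-- Riedtmann's formula: counting extensions with class in `E`, weighted by the automorphisms of
the middle term. -/
theorem finsum_card_extCls_mem [∀ X Y : C, Finite (X ⟶ Y)] (T D : C) [Finite (Ext.{w} T D 1)]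
    (E : Set (Ext.{w} T D 1)) :
    ∑ᶠ R : IsoClass C, (Nat.card {z : exactSeqs T D R.out // extCls z ∈ E} : ℂ) / autCard R =
      Nat.card E / Nat.card (T ⟶ D) := by
  have := Fintype.ofFinite E
  -- Each class is realized by some `y e` with middle term `S e`; by `card_iso_eq` the extensions
  -- with middle term `R` and class `e` number `#Iso(S e, R) / #Hom(T, D)`.
  choose S y hy using fun e : E => exists_cls_eq e.1
  have hT : (Nat.card (T ⟶ D) : ℂ) ≠ 0 := by exact_mod_cast Nat.card_pos.ne'
  have key : ∀ R : IsoClass C,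
      (Nat.card {z : exactSeqs T D R.out // extCls z ∈ E} : ℂ) / autCard R =
        ∑ e : E, (Nat.card (S e ≅ R.out) : ℂ) / autCard R / Nat.card (T ⟶ D) := by
    intro R
    have h₁ : Nat.card {z : exactSeqs T D R.out // extCls z ∈ E} =
        ∑ e : E, Nat.card {z : exactSeqs T D R.out // extCls z = e.1} := by
      rw [← Nat.card_sigma]
      exact Nat.card_congr
        { toFun := fun z => ⟨⟨_, z.2⟩, z.1, rfl⟩
          invFun := fun s => ⟨s.2.1, by rw [s.2.2]; exact s.1.2⟩
          left_inv := fun z => rfl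
          right_inv := by
            rintro ⟨⟨e, he⟩, z, hz⟩
            dsimp at hz
            subst hz
            rfl }
    rw [h₁, Nat.cast_sum, Finset.sum_div]
    refine Finset.sum_congr rfl fun e _ => ?_
    rw [card_iso_eq.{w} (y e) R.out, hy e, Nat.cast_mul]
    field_simp
  simp_rw [key]
  rw [finsum_sum_comm]
  · simp_rw [div_eq_mul_inv _ (Nat.card (T ⟶ D) : ℂ), ← finsum_mul, finsum_card_iso]
    simp
  · intro e _
    exact hasFiniteSupport_card_iso (S e)
      (fun n R => (n : ℂ) / autCard R / Nat.card (T ⟶ D)) (by simp)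

variable {A B G D M N P Q T : C}

/-- Lifts of `N` and `Q` exist exactly when the class of the extension restricts to those of `x₂`
and `x₄`. They then form torsors under `Hom(G, D)` and `Hom(B, D)`. -/
theorem card_isCompatible {x₁ : exactSeqs A B M} {x₂ : exactSeqs G D N} {x₃ : exactSeqs A G P}
    {x₄ : exactSeqs B D Q} {t₁ : T ⟶ M} {t₃ : T ⟶ P}
    (sq : IsPullback t₁ t₃ x₁.1.2 x₃.1.2) {u : G ⟶ T} (hu₁ : u ≫ t₁ = 0) (hu₃ : u ≫ t₃ = x₃.1.1)
    {v : B ⟶ T} (hv₁ : v ≫ t₁ = x₁.1.1) (hv₃ : v ≫ t₃ = 0) (R : C) :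
    Nat.card {y : exactSeqs M N R × exactSeqs P Q R //
        IsCompatible x₁.1 x₂.1 x₃.1 x₄.1 y.1.1 y.2.1} =
      Nat.card {z : exactSeqs T D R // extCls z ∈ {e : Ext.{w} T D 1 |
        (Ext.mk₀ u).comp e (zero_add 1) = extCls x₂ ∧
          (Ext.mk₀ v).comp e (zero_add 1) = extCls x₄}} *
        (Nat.card (G ⟶ D) * Nat.card (B ⟶ D)) := by
  obtain ⟨e⟩ := nonempty_isCompatible_equiv x₁.2 x₂.2 x₃.2 x₄.2 sq hu₁ hu₃ hv₁ hv₃ R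
  rw [Nat.card_congr e, ← Nat.card_prod, ← Nat.card_prod]
  have h : ∀ z : {z : exactSeqs T D R // extCls z ∈ {e : Ext.{w} T D 1 |
        (Ext.mk₀ u).comp e (zero_add 1) = extCls x₂ ∧
          (Ext.mk₀ v).comp e (zero_add 1) = extCls x₄}},
      Nonempty (middleMaps D R T z.1.1 x₂.1 u × middleMaps D R T z.1.1 x₄.1 v ≃
        (G ⟶ D) × (B ⟶ D)) := by
    rintro ⟨z, hz₁, hz₂⟩
    obtain ⟨e₁⟩ := nonempty_middleMaps_equiv z.2 x₂.2 ((middleMaps_nonempty_iff.{w} _ _ _).2 hz₁)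
    obtain ⟨e₂⟩ := nonempty_middleMaps_equiv z.2 x₄.2 ((middleMaps_nonempty_iff.{w} _ _ _).2 hz₂)
    exact ⟨(e₁.prodCongr e₂).symm⟩
  refine Nat.card_congr (Equiv.trans ?_ ((Equiv.sigmaCongrRight fun z => (h z).some).trans
    (Equiv.sigmaEquivProd _ _)))
  exact
    { toFun := fun s => ⟨⟨s.1, (middleMaps_nonempty_iff.{w} _ _ _).1 ⟨_, s.2.1.2⟩,
        (middleMaps_nonempty_iff.{w} _ _ _).1 ⟨_, s.2.2.2⟩⟩, s.2⟩
      invFun := fun s => ⟨s.1.1, s.2⟩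
      left_inv := fun s => rfl
      right_inv := fun s => rfl }

/-- In a hereditary category, restriction to two independent subobjects is surjective on
`Ext¹`. -/
theorem exists_ext_restrict_eq [Hereditary C] {u : G ⟶ T} {v : B ⟶ T}
    (huv : Mono (Limits.biprod.desc u v)) (ξ : Ext.{w} G D 1) (η : Ext.{w} B D 1) :
    ∃ e : Ext.{w} T D 1, (Ext.mk₀ u).comp e (zero_add 1) = ξ ∧
      (Ext.mk₀ v).comp e (zero_add 1) = η := by
  have hS : (ShortComplex.mk (Limits.biprod.desc u v) (Limits.cokernel.π _)
      (Limits.cokernel.condition _)).ShortExact :=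
    { exact := ShortComplex.exact_cokernel _ }
  have := Hereditary.projectiveDimension_le (Limits.cokernel (Limits.biprod.desc u v))
  -- The obstruction to extending the class on `G ⊞ B` to `T` lies in `Ext²` of the cokernel, which
  -- vanishes.
  obtain ⟨e, he⟩ := Ext.contravariant_sequence_exact₁ hS D
    ((Ext.mk₀ Limits.biprod.fst).comp ξ (zero_add 1) +
      (Ext.mk₀ Limits.biprod.snd).comp η (zero_add 1)) (n₁ := 2) rfl
    (Ext.eq_zero_of_hasProjectiveDimensionLT _ 2 le_rfl)
  dsimp at he
  refine ⟨e, ?_, ?_⟩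
  · have hu : u = Limits.biprod.inl ≫ Limits.biprod.desc u v := by simp
    rw [hu, ← Ext.mk₀_comp_mk₀, Ext.comp_assoc_of_second_deg_zero, he]
    simp [Ext.comp_add]
  · have hv : v = Limits.biprod.inr ≫ Limits.biprod.desc u v := by simp
    rw [hv, ← Ext.mk₀_comp_mk₀, Ext.comp_assoc_of_second_deg_zero, he]
    simp [Ext.comp_add]

/-- Restriction is a surjective homomorphism of finite groups, so every fibre has the order of the
kernel. -/
theorem card_ext_restrict_eq [Finitary.{w} C] [Hereditary C] {u : G ⟶ T} {v : B ⟶ T}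
    (huv : Mono (Limits.biprod.desc u v)) (ξ : Ext.{w} G D 1) (η : Ext.{w} B D 1) :
    Nat.card {e : Ext.{w} T D 1 | (Ext.mk₀ u).comp e (zero_add 1) = ξ ∧
      (Ext.mk₀ v).comp e (zero_add 1) = η} *
        (Nat.card (Ext.{w} G D 1) * Nat.card (Ext.{w} B D 1)) = Nat.card (Ext.{w} T D 1) := by
  rw [← Nat.card_prod, ← card_fiber_mul_card (((Ext.mk₀ u).precomp D (zero_add 1)).prod
    ((Ext.mk₀ v).precomp D (zero_add 1))) ?_ (ξ, η)]
  · congr 1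
    refine Nat.card_congr (Equiv.subtypeEquivRight fun e => ?_)
    simp [Prod.ext_iff]
  · rintro ⟨ξ, η⟩
    obtain ⟨e, he₁, he₂⟩ := exists_ext_restrict_eq huv ξ η
    exact ⟨e, Prod.ext he₁ he₂⟩

theorem card_hom_eq_card_ext (X Y : C) : Nat.card (X ⟶ Y) = Nat.card (Ext.{w} X Y 0) :=
  Nat.card_congr Ext.homEquiv₀.symm

/-- Additivity of the Euler form for `T = G + M = G + A + B` in the Grothendieck group, with
denominators cleared. -/
theorem card_euler_of_pullback [Finitary.{w} C] [Hereditary C] {x₁ : (B ⟶ M) × (M ⟶ A)}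
    (hx₁ : x₁ ∈ exactSeqs A B M) {y : (G ⟶ T) × (T ⟶ M)} (hy : y ∈ exactSeqs M G T) (D : C) :
    ((Nat.card (Ext.{w} T D 1) : ℂ) * Nat.card (Ext.{w} G D 0) * Nat.card (Ext.{w} B D 0) *
        Nat.card (Ext.{w} A D 0)) =
      Nat.card (Ext.{w} T D 0) * Nat.card (Ext.{w} G D 1) * Nat.card (Ext.{w} B D 1) *
        Nat.card (Ext.{w} A D 1) := by
  have h₁ := logEuler_contravariant.{w} D _ hx₁.choose_spec
  have h₂ := logEuler_contravariant.{w} D _ hy.choose_spec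
  have h0 : ∀ X : C, 0 < (Nat.card (Ext.{w} X D 0) : ℝ) := fun X => by
    exact_mod_cast Nat.card_pos
  have h1 : ∀ X : C, 0 < (Nat.card (Ext.{w} X D 1) : ℝ) := fun X => by
    exact_mod_cast Nat.card_pos
  have key : (Nat.card (Ext.{w} T D 1) : ℝ) * Nat.card (Ext.{w} G D 0) *
        Nat.card (Ext.{w} B D 0) * Nat.card (Ext.{w} A D 0) =
      Nat.card (Ext.{w} T D 0) * Nat.card (Ext.{w} G D 1) * Nat.card (Ext.{w} B D 1) *
        Nat.card (Ext.{w} A D 1) := by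
    refine Real.log_injOn_pos
      (mul_pos (mul_pos (mul_pos (h1 _) (h0 _)) (h0 _)) (h0 _))
      (mul_pos (mul_pos (mul_pos (h0 _) (h1 _)) (h1 _)) (h1 _)) ?_
    simp only [logEuler] at h₁ h₂
    rw [Real.log_mul, Real.log_mul, Real.log_mul, Real.log_mul, Real.log_mul, Real.log_mul]
    · linarith
    all_goals simp only [ne_eq, mul_eq_zero, (h0 _).ne', (h1 _).ne', or_self,
      not_false_eq_true]
  exact_mod_cast key

/-- The number of crosses compatible with a frame, weighted by the automorphisms of the middle
term. -/
theorem finsum_card_isCompatible [Finitary.{w} C] [Hereditary C] (x₁ : exactSeqs A B M)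
    (x₂ : exactSeqs G D N) (x₃ : exactSeqs A G P) (x₄ : exactSeqs B D Q) :
    ∑ᶠ R : IsoClass C, (Nat.card {y : exactSeqs M N R.out × exactSeqs P Q R.out //
        IsCompatible x₁.1 x₂.1 x₃.1 x₄.1 y.1.1 y.2.1} : ℂ) / autCard R =
      Nat.card (Ext.{w} A D 1) / Nat.card (Ext.{w} A D 0) := by
  have := Finitary.finite_hom.{w} (C := C)
  let T := Limits.pullback x₁.1.2 x₃.1.2
  let t₁ : T ⟶ M := Limits.pullback.fst _ _
  let t₃ : T ⟶ P := Limits.pullback.snd _ _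
  have sq : IsPullback t₁ t₃ x₁.1.2 x₃.1.2 := IsPullback.of_hasPullback _ _
  let u : G ⟶ T := sq.lift 0 x₃.1.1 (by simp [exactSeqs_comp x₃.2])
  let v : B ⟶ T := sq.lift x₁.1.1 0 (by simp [exactSeqs_comp x₁.2])
  have hu₁ : u ≫ t₁ = 0 := sq.lift_fst _ _ _
  have hu₃ : u ≫ t₃ = x₃.1.1 := sq.lift_snd _ _ _
  have hv₁ : v ≫ t₁ = x₁.1.1 := sq.lift_fst _ _ _
  have hv₃ : v ≫ t₃ = 0 := sq.lift_snd _ _ _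
  -- `G` and `B` meet trivially in `T`: `G` dies in `M` and embeds in `P`, while `B` dies in `P` and
  -- embeds in `M`.
  have huv : Mono (Limits.biprod.desc u v) := by
    have := exactSeqs_mono x₁.2
    have := exactSeqs_mono x₃.2
    refine Preadditive.mono_of_cancel_zero _ fun {Z} k hk => ?_
    have h₁ := hk =≫ t₁
    have h₃ := hk =≫ t₃
    apply Limits.biprod.hom_ext
    · rw [Limits.zero_comp, ← cancel_mono x₃.1.1]
      simpa [Limits.biprod.desc_eq, hu₃, hv₃] using h₃
    · rw [Limits.zero_comp, ← cancel_mono x₁.1.1]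
      simpa [Limits.biprod.desc_eq, hu₁, hv₁] using h₁
  have hE := card_ext_restrict_eq huv (extCls.{w} x₂) (extCls.{w} x₄)
  have hχ := card_euler_of_pullback.{w} x₁.2 (mem_exactSeqs_of_isPullback x₃.2 sq hu₁ hu₃) D
  simp_rw [card_isCompatible.{w} sq hu₁ hu₃ hv₁ hv₃, Nat.cast_mul, mul_div_right_comm]
  rw [← finsum_mul, finsum_card_extCls_mem, div_mul_eq_mul_div, div_eq_div_iff]
  · rw [← hE] at hχ
    simp only [card_hom_eq_card_ext.{w}]
    push_cast at hχ
    have h1 : ∀ X : C, (Nat.card (Ext.{w} X D 1) : ℂ) ≠ 0 := fun X => by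
      exact_mod_cast Nat.card_pos.ne'
    -- These factors turn the size of the fibre into `#Ext¹(T, D)`, the form in which the Euler
    -- identity `hχ` applies.
    refine mul_right_cancel₀ (mul_ne_zero (h1 G) (h1 B)) ?_
    linear_combination hχ
  · exact_mod_cast Nat.card_pos.ne'
  · exact_mod_cast Nat.card_pos.ne'

end Counting

/-! ### Frames compatible with a given cross -/

section Frames

variable {C : Type u} [Category.{v} C] [Abelian C]

section Comparison

variable {A B G D A' B' G' D' M N P Q R : C}

theorem mem_exactSeqs_of_desc {x : (N ⟶ R) × (R ⟶ M)} (h : x.1 ≫ x.2 = 0) (h₁ : Mono x.1)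
    (h₂ : Epi x.2) (hl : ∀ {Z : C} (k : R ⟶ Z), x.1 ≫ k = 0 → ∃ l : M ⟶ Z, x.2 ≫ l = k) :
    x ∈ exactSeqs M N R := by
  refine mem_exactSeqs_of_lift h h₁ h₂ fun {Z} k hk => ?_
  obtain ⟨l, hl⟩ := hl (Limits.cokernel.π x.1) (Limits.cokernel.condition _)
  have hk' : k ≫ Limits.cokernel.π x.1 = 0 := by rw [← hl, reassoc_of% hk, Limits.zero_comp]
  exact ⟨(ShortComplex.exact_cokernel x.1).lift k hk',
    (ShortComplex.exact_cokernel x.1).lift_f k hk'⟩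

/-- The kernel, the image and the cokernel of a morphism do not depend on choices. -/
theorem exists_comparison {x : (D ⟶ N) × (N ⟶ G)} {y : (G ⟶ P) × (P ⟶ A)}
    {x' : (D' ⟶ N) × (N ⟶ G')} {y' : (G' ⟶ P) × (P ⟶ A')} (hx : x ∈ exactSeqs G D N)
    (hy : y ∈ exactSeqs A G P) (hx' : x' ∈ exactSeqs G' D' N) (hy' : y' ∈ exactSeqs A' G' P)
    (h : x.2 ≫ y.1 = x'.2 ≫ y'.1) :
    (∃ δ : D ≅ D', δ.hom ≫ x'.1 = x.1) ∧
      (∃ γ : G ≅ G', x.2 ≫ γ.hom = x'.2 ∧ γ.hom ≫ y'.1 = y.1) ∧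
      ∃ α : A ≅ A', y.2 ≫ α.hom = y'.2 := by
  -- Morphisms in one direction suffice: exchanging the factorizations gives the inverses.
  have key : ∀ {A G D : C} {A' G' D' : C} {x : (D ⟶ N) × (N ⟶ G)} {y : (G ⟶ P) × (P ⟶ A)}
      {x' : (D' ⟶ N) × (N ⟶ G')} {y' : (G' ⟶ P) × (P ⟶ A')}, x ∈ exactSeqs G D N →
      y ∈ exactSeqs A G P → x' ∈ exactSeqs G' D' N → y' ∈ exactSeqs A' G' P →
      x.2 ≫ y.1 = x'.2 ≫ y'.1 → (∃ δ : D ⟶ D', δ ≫ x'.1 = x.1) ∧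
        (∃ γ : G ⟶ G', x.2 ≫ γ = x'.2 ∧ γ ≫ y'.1 = y.1) ∧ ∃ α : A ⟶ A', y.2 ≫ α = y'.2 := by
    intro A G D A' G' D' x y x' y' hx hy hx' hy' h
    have := exactSeqs_mono hy'
    have := exactSeqs_epi hx
    have h₁ : x.1 ≫ x'.2 = 0 := by
      rw [← cancel_mono y'.1, Category.assoc, ← h, ← Category.assoc, exactSeqs_comp hx,
        Limits.zero_comp, Limits.zero_comp]
    have h₂ : y.1 ≫ y'.2 = 0 := by
      rw [← cancel_epi x.2, reassoc_of% h, exactSeqs_comp hy', Limits.comp_zero, Limits.comp_zero]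
    obtain ⟨γ, hγ⟩ := exactSeqs_exists_desc hx x'.2 h₁
    exact ⟨exactSeqs_exists_lift hx' x.1 h₁,
      ⟨γ, hγ, by rw [← cancel_epi x.2, reassoc_of% hγ, h]⟩, exactSeqs_exists_desc hy y'.2 h₂⟩
  have := exactSeqs_mono hx
  have := exactSeqs_mono hx'
  have := exactSeqs_epi hx
  have := exactSeqs_epi hx'
  have := exactSeqs_epi hy
  have := exactSeqs_epi hy'
  obtain ⟨⟨δ, hδ⟩, ⟨γ, hγ, hγ'⟩, α, hα⟩ := key hx hy hx' hy' h
  obtain ⟨⟨δ', hδ'⟩, ⟨γ', hγ'', -⟩, α', hα'⟩ := key hx' hy' hx hy h.symm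
  exact ⟨⟨⟨δ, δ', by simp [← cancel_mono x.1, hδ, hδ'], by simp [← cancel_mono x'.1, hδ, hδ']⟩, hδ⟩,
    ⟨⟨γ, γ', by simp [← cancel_epi x.2, reassoc_of% hγ, hγ''],
      by simp [← cancel_epi x'.2, reassoc_of% hγ'', hγ]⟩, hγ, hγ'⟩,
    ⟨⟨α, α', by simp [← cancel_epi y.2, reassoc_of% hα, hα'],
      by simp [← cancel_epi y'.2, reassoc_of% hα', hα]⟩, hα⟩⟩

/-- Four short exact sequences forming the sides of a square with corners `N`, `M`, `P`, `Q` and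
edges `D`, `B`, `G`, `A`. -/
abbrev Frame (M N P Q A B G D : C) : Type v :=
  (exactSeqs A B M × exactSeqs G D N) × (exactSeqs A G P × exactSeqs B D Q)

/-- Compatibility of a frame with a cross. -/
abbrev Frame.Compat (x : Frame M N P Q A B G D) (y : exactSeqs M N R × exactSeqs P Q R) : Prop :=
  IsCompatible x.1.1.1 x.1.2.1 x.2.1.1 x.2.2.1 y.1.1 y.2.1

/-- Viewing `N` and `Q` as subobjects of `R`, both `N ⟶ P` and `Q ⟶ M` have kernel `N ∩ Q` and
cokernel `R / (N + Q)`. These are `D` and `A`; the two images are `G` and `B`. -/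
theorem exists_frame (y : exactSeqs M N R × exactSeqs P Q R) :
    ∃ (A B G D : C) (x : Frame M N P Q A B G D), x.Compat y := by
  obtain ⟨⟨y₁, hy₁⟩, ⟨y₂, hy₂⟩⟩ := y
  have := exactSeqs_mono hy₁
  have := exactSeqs_mono hy₂
  have := exactSeqs_epi hy₁
  have := exactSeqs_epi hy₂
  let f := y₁.1 ≫ y₂.2
  let g := y₂.1 ≫ y₁.2
  have hf : Abelian.factorThruImage f ≫ Abelian.image.ι f = y₁.1 ≫ y₂.2 := Abelian.image.fac f
  have hg : Abelian.factorThruImage g ≫ Abelian.image.ι g = y₂.1 ≫ y₁.2 := Abelian.image.fac g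
  have hfk : Limits.kernel.ι f ≫ y₁.1 ≫ y₂.2 = 0 := Limits.kernel.condition f
  have hfc : y₁.1 ≫ y₂.2 ≫ Limits.cokernel.π f = 0 := by
    rw [← Category.assoc]
    exact Limits.cokernel.condition f
  obtain ⟨l, hl⟩ := exactSeqs_exists_lift hy₂ (Limits.kernel.ι f ≫ y₁.1) (by simpa using hfk)
  obtain ⟨m, hm⟩ := exactSeqs_exists_desc hy₁ (y₂.2 ≫ Limits.cokernel.π f) hfc
  have hx₂ : (Limits.kernel.ι f, Abelian.factorThruImage f) ∈
      exactSeqs (Abelian.image f) (Limits.kernel f) N := by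
    refine mem_exactSeqs_of_lift ?_ inferInstance inferInstance fun k hk => ?_
    · rw [← cancel_mono (Abelian.image.ι f)]
      simp
    · exact ⟨Limits.kernel.lift f k (by
        rw [← Abelian.image.fac f, ← Category.assoc]
        dsimp at hk
        rw [hk, Limits.zero_comp]), by simp⟩
  have hx₃ : (Abelian.image.ι f, Limits.cokernel.π f) ∈
      exactSeqs (Limits.cokernel f) (Abelian.image f) P := by
    refine mem_exactSeqs_of_desc (Limits.kernel.condition _) inferInstance inferInstance
      fun k hk => ?_
    exact ⟨Limits.cokernel.desc f k (by
      dsimp at hk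
      rw [← Abelian.image.fac f, Category.assoc, hk, Limits.comp_zero]), by simp⟩
  have hx₄ : (l, Abelian.factorThruImage g) ∈
      exactSeqs (Abelian.image g) (Limits.kernel f) Q := by
    have hlm : Mono (l ≫ y₂.1) := by rw [hl]; infer_instance
    refine mem_exactSeqs_of_lift ?_ (mono_of_mono l y₂.1) inferInstance fun k hk => ?_
    · rw [← cancel_mono (Abelian.image.ι g), Category.assoc, hg, reassoc_of% hl, exactSeqs_comp hy₁,
        Limits.comp_zero, Limits.zero_comp]
    · dsimp at hk
      have hk' : (k ≫ y₂.1) ≫ y₁.2 = 0 := by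
        rw [Category.assoc, ← hg, reassoc_of% hk, Limits.zero_comp]
      obtain ⟨n, hn⟩ := exactSeqs_exists_lift hy₁ _ hk'
      refine ⟨Limits.kernel.lift f n ?_, ?_⟩
      · simp only [f]
        rw [reassoc_of% hn, exactSeqs_comp hy₂, Limits.comp_zero]
      · rw [← cancel_mono y₂.1, Category.assoc, hl, Limits.kernel.lift_ι_assoc, hn]
  have hx₁ : (Abelian.image.ι g, m) ∈ exactSeqs (Limits.cokernel f) (Abelian.image g) M := by
    have hme : Epi (y₁.2 ≫ m) := by rw [hm]; infer_instance
    refine mem_exactSeqs_of_desc ?_ inferInstance (epi_of_epi y₁.2 m) fun k hk => ?_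
    · rw [← cancel_epi (Abelian.factorThruImage g), reassoc_of% hg, hm,
        reassoc_of% exactSeqs_comp hy₂, Limits.zero_comp, Limits.comp_zero]
    · dsimp at hk
      have hk' : y₂.1 ≫ y₁.2 ≫ k = 0 := by
        rw [← reassoc_of% hg, hk, Limits.comp_zero]
      obtain ⟨n, hn⟩ := exactSeqs_exists_desc hy₂ _ hk'
      refine ⟨Limits.cokernel.desc f n ?_, ?_⟩
      · simp only [f]
        rw [Category.assoc, hn, reassoc_of% exactSeqs_comp hy₁, Limits.zero_comp]
      · rw [← cancel_epi y₁.2, reassoc_of% hm, Limits.cokernel.π_desc, hn]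
  exact ⟨_, _, _, _, ⟨(⟨_, hx₁⟩, ⟨_, hx₂⟩), (⟨_, hx₃⟩, ⟨_, hx₄⟩)⟩,
    { upper_left := hl.symm, lower_left := hf.symm, upper_right := hg.symm, lower_right := hm }⟩

/-- The frames compatible with a given cross form a torsor under the automorphisms of the
edges. -/
theorem card_compat {x : Frame M N P Q A B G D} {y : exactSeqs M N R × exactSeqs P Q R}
    (h : x.Compat y) (A' B' G' D' : C) :
    Nat.card {x' : Frame M N P Q A' B' G' D' // x'.Compat y} =
      Nat.card (A ≅ A') * Nat.card (B ≅ B') * (Nat.card (G ≅ G') * Nat.card (D ≅ D')) := by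
  rw [← Nat.card_prod, ← Nat.card_prod, ← Nat.card_prod]
  symm
  obtain ⟨⟨⟨⟨i₁, p₁⟩, hx₁⟩, ⟨⟨i₂, p₂⟩, hx₂⟩⟩, ⟨⟨i₃, p₃⟩, hx₃⟩, ⟨⟨i₄, p₄⟩, hx₄⟩⟩ := x
  obtain ⟨⟨⟨a, b⟩, hy₁⟩, ⟨⟨a', b'⟩, hy₂⟩⟩ := y
  have := exactSeqs_mono hx₁
  have := exactSeqs_mono hx₂
  have := exactSeqs_mono hx₃
  have := exactSeqs_mono hx₄
  have := exactSeqs_epi hx₁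
  have := exactSeqs_epi hx₂
  have := exactSeqs_epi hx₃
  have := exactSeqs_epi hx₄
  have := exactSeqs_mono hy₂
  have := exactSeqs_epi hy₁
  obtain ⟨e₁, e₂, e₃, e₄⟩ := h
  dsimp at *
  refine Nat.card_congr (Equiv.ofBijective (fun s =>
    ⟨⟨(⟨(s.1.2.inv ≫ i₁, p₁ ≫ s.1.1.hom), ?_⟩, ⟨(s.2.2.inv ≫ i₂, p₂ ≫ s.2.1.hom), ?_⟩),
      (⟨(s.2.1.inv ≫ i₃, p₃ ≫ s.1.1.hom), ?_⟩, ⟨(s.2.2.inv ≫ i₄, p₄ ≫ s.1.2.hom), ?_⟩)⟩, ?_⟩)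
    ⟨?_, ?_⟩)
  · simpa using exactSeqs_of_iso s.1.1 s.1.2 (Iso.refl M) hx₁
  · simpa using exactSeqs_of_iso s.2.1 s.2.2 (Iso.refl N) hx₂
  · simpa using exactSeqs_of_iso s.1.1 s.2.1 (Iso.refl P) hx₃
  · simpa using exactSeqs_of_iso s.1.2 s.2.2 (Iso.refl Q) hx₄
  · exact { upper_left := by simp [e₁], lower_left := by simp [e₂],
            upper_right := by simp [e₃], lower_right := by simp [reassoc_of% e₄] }
  · rintro ⟨⟨α, β⟩, γ, δ⟩ ⟨⟨α', β'⟩, γ', δ'⟩ hs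
    simp only [Subtype.mk.injEq, Prod.mk.injEq, cancel_epi, cancel_mono] at hs
    obtain ⟨⟨⟨-, hα⟩, hδ, hγ⟩, -, -, hβ⟩ := hs
    have hδ' : δ = δ' := by
      rw [← Iso.symm_eq_iff]
      exact Iso.ext hδ
    rw [Iso.ext hα, Iso.ext hβ, Iso.ext hγ, hδ']
  · rintro ⟨⟨⟨⟨⟨i₁', p₁'⟩, hx₁'⟩, ⟨⟨i₂', p₂'⟩, hx₂'⟩⟩, ⟨⟨i₃', p₃'⟩, hx₃'⟩, ⟨⟨i₄', p₄'⟩, hx₄'⟩⟩,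
      e₁', e₂', e₃', e₄'⟩
    dsimp at *
    obtain ⟨⟨δ, hδ⟩, ⟨γ, hγ, hγ'⟩, α, hα⟩ :=
      exists_comparison hx₂ hx₃ hx₂' hx₃' (e₂.symm.trans e₂')
    obtain ⟨-, ⟨β, hβ, hβ'⟩, -⟩ :=
      exists_comparison hx₄ hx₁ hx₄' hx₁' (e₃.symm.trans e₃')
    dsimp at *
    -- `α` and `δ` come from the factorizations of `N ⟶ P` alone; the cross forces them to be
    -- compatible with `M ⟶ A` and `D ⟶ Q` as well.
    have hα' : p₁ ≫ α.hom = p₁' := by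
      rw [← cancel_epi b, reassoc_of% e₄, hα, e₄']
    have hδ' : δ.hom ≫ i₄' = i₄ := by
      rw [← cancel_mono a', Category.assoc, ← e₁', reassoc_of% hδ, e₁]
    refine ⟨((α, β), (γ, δ)), ?_⟩
    simp [← hβ', ← hα', ← hδ, ← hγ, ← hγ', ← hα, ← hδ', ← hβ]

end Comparison

end Frames

/-! ### Green's formula by double counting -/

section Green

theorem finsum_comm_of_finite {α β : Type*} {s : Set α} {t : Set β} (hs : s.Finite)
    (ht : t.Finite) (f : α → β → ℂ) (hf : ∀ a b, f a b ≠ 0 → a ∈ s ∧ b ∈ t) :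
    ∑ᶠ a, ∑ᶠ b, f a b = ∑ᶠ b, ∑ᶠ a, f a b := by
  have h₁ : ∀ a, ∑ᶠ b, f a b = ∑ b ∈ ht.toFinset, f a b := fun a =>
    finsum_eq_sum_of_support_subset _ fun b hb => by simpa using (hf a b hb).2
  have h₂ : ∀ b, ∑ᶠ a, f a b = ∑ a ∈ hs.toFinset, f a b := fun b =>
    finsum_eq_sum_of_support_subset _ fun a ha => by simpa using (hf a b ha).1
  simp_rw [h₁]
  rw [finsum_sum_comm]
  · simp_rw [h₂]
    refine (finsum_eq_sum_of_support_subset _ fun b hb => ?_).symm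
    obtain ⟨a, -, ha⟩ := Finset.exists_ne_zero_of_sum_ne_zero hb
    simpa using (hf a b ha).2
  · exact fun b _ => hs.subset fun a ha => (hf a b ha).1

variable {C : Type u} [Category.{v} C]

theorem isoClass_eq_of_iso {X Y : IsoClass C} (e : X.out ≅ Y.out) : X = Y := by
  rw [← Quotient.out_eq X, ← Quotient.out_eq Y]
  exact Quotient.sound (s := isIsomorphicSetoid C) ⟨e⟩

variable [Abelian C]

variable (C) in
/-- Quadruples of isomorphism classes of objects, the edges of a frame. -/
abbrev Edges : Type u := (IsoClass C × IsoClass C) × (IsoClass C × IsoClass C)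

/-- Frames with edges in given isomorphism classes. -/
abbrev EdgeFrame (M N P Q : C) (t : Edges C) : Type v :=
  Frame M N P Q t.1.1.out t.1.2.out t.2.1.out t.2.2.out

/-- Only finitely many quadruples of isomorphism classes occur as the edges of frames with given
corners. -/
theorem finite_nonempty_edgeFrame [∀ X Y : C, Finite (X ⟶ Y)] (M N P Q : C) :
    {t : Edges C | Nonempty (EdgeFrame M N P Q t)}.Finite := by
  let F : ∀ t : {t : Edges C | Nonempty (EdgeFrame M N P Q t)}, EdgeFrame M N P Q t.1 :=
    fun t => Classical.choice t.2
  have : Finite {t : Edges C | Nonempty (EdgeFrame M N P Q t)} := by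
    -- The composites `N ⟶ G ⟶ P` and `Q ⟶ B ⟶ M` determine all four edges up to isomorphism.
    refine Finite.of_injective (fun t => (((F t).1.2.1.2 ≫ (F t).2.1.1.1 : N ⟶ P),
      ((F t).2.2.1.2 ≫ (F t).1.1.1.1 : Q ⟶ M))) fun t t' h => ?_
    obtain ⟨h₁, h₂⟩ := Prod.ext_iff.1 h
    obtain ⟨⟨δ, -⟩, ⟨γ, -⟩, ⟨α, -⟩⟩ := exists_comparison (F t).1.2.2 (F t).2.1.2 (F t').1.2.2
      (F t').2.1.2 h₁
    obtain ⟨-, ⟨β, -⟩, -⟩ := exists_comparison (F t).2.2.2 (F t).1.1.2 (F t').2.2.2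
      (F t').1.1.2 h₂
    exact Subtype.ext (Prod.ext (Prod.ext (isoClass_eq_of_iso α) (isoClass_eq_of_iso β))
      (Prod.ext (isoClass_eq_of_iso γ) (isoClass_eq_of_iso δ)))
  exact Set.toFinite _

/-- The product of the orders of the automorphism groups of the edges. -/
noncomputable def edgesAutCard (t : Edges C) : ℂ :=
  (autCard t.1.1 : ℂ) * autCard t.1.2 * (autCard t.2.1 * autCard t.2.2)

/-- Only the edges of the canonical frame contribute, and for them the number of frames is the
product of the orders of their automorphism groups. -/
theorem finsum_card_compat [∀ X Y : C, Finite (X ⟶ Y)] {M N P Q R : C}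
    (y : exactSeqs M N R × exactSeqs P Q R) :
    ∑ᶠ t : Edges C, (Nat.card {x : EdgeFrame M N P Q t // x.Compat y} : ℂ) / edgesAutCard t =
      1 := by
  obtain ⟨A, B, G, D, x, hx⟩ := exists_frame y
  rw [finsum_eq_single _ ((isoClass A, isoClass B), (isoClass G, isoClass D))]
  · rw [card_compat hx]
    simp only [card_iso_out_isoClass, edgesAutCard]
    push_cast
    exact div_self (mul_ne_zero (mul_ne_zero (autCard_ne_zero _) (autCard_ne_zero _))
      (mul_ne_zero (autCard_ne_zero _) (autCard_ne_zero _)))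
  · rintro ⟨⟨A', B'⟩, G', D'⟩ ht
    rw [card_compat hx]
    suffices h : Nat.card (A ≅ A'.out) * Nat.card (B ≅ B'.out) *
        (Nat.card (G ≅ G'.out) * Nat.card (D ≅ D'.out)) = 0 by
      simp only [h, Nat.cast_zero, zero_div]
    by_contra h
    simp only [mul_eq_zero, not_or] at h
    refine ht ?_
    rw [Prod.mk.injEq, Prod.mk.injEq, Prod.mk.injEq]
    refine ⟨⟨?_, ?_⟩, ?_, ?_⟩ <;> by_contra h'
    · exact h.1.1 (card_iso_out_of_ne h')
    · exact h.1.2 (card_iso_out_of_ne h')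
    · exact h.2.1 (card_iso_out_of_ne h')
    · exact h.2.2 (card_iso_out_of_ne h')

theorem card_subtype_prod_eq_sum {α β : Type*} [Fintype α] [Finite β] (r : α → β → Prop) :
    Nat.card {p : α × β // r p.1 p.2} = ∑ a, Nat.card {b // r a b} := by
  rw [← Nat.card_sigma]
  exact Nat.card_congr
    { toFun := fun p => ⟨p.1.1, p.1.2, p.2⟩
      invFun := fun s => ⟨(s.1, s.2.1), s.2.2⟩
      left_inv := fun p => rfl
      right_inv := fun s => rfl }

theorem hallP_eq_card (M N R : IsoClass C) :
    hallP M N R = Nat.card (exactSeqs M.out N.out R.out) := (Nat.card_coe_set_eq _).symm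

/-- Green's formula. -/
theorem green_formula [HasExt.{w} C] [Finitary.{w} C] [Hereditary C] (M N P Q : IsoClass C) :
    ∑ᶠ R : IsoClass C, (hallP M N R : ℂ) * hallP P Q R / autCard R =
      ∑ᶠ t : Edges C, (hallP t.1.1 t.1.2 M : ℂ) * hallP t.2.1 t.2.2 N * hallP t.1.1 t.2.1 P *
        hallP t.1.2 t.2.2 Q / edgesAutCard t *
        ((Nat.card (Ext.{w} t.1.1.out t.2.2.out 1) : ℂ) /
          Nat.card (Ext.{w} t.1.1.out t.2.2.out 0)) := by
  have := Finitary.finite_hom.{w} (C := C)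
  let Y : IsoClass C → Type v := fun R => exactSeqs M.out N.out R.out × exactSeqs P.out Q.out R.out
  let F : Edges C → Type v := EdgeFrame M.out N.out P.out Q.out
  have hY : ∀ R, Fintype (Y R) := fun R => Fintype.ofFinite _
  have hF : ∀ t, Fintype (F t) := fun t => Fintype.ofFinite _
  -- The number of compatible pairs. Summing over frames for each cross gives the left side (`h₁`);
  -- summing over crosses for each frame gives the right side (`h₂`).
  let c : IsoClass C → Edges C → ℕ := fun R t =>
    Nat.card {p : F t × Y R // Frame.Compat p.1 p.2}
  have h₁ : ∀ R : IsoClass C, (hallP M N R : ℂ) * hallP P Q R / autCard R =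
      ∑ᶠ t, (c R t : ℂ) / edgesAutCard t / autCard R := by
    intro R
    have hc : ∀ t, c R t = ∑ y : Y R, Nat.card {x : F t // Frame.Compat x y} := fun t => by
      rw [← card_subtype_prod_eq_sum (fun (y : Y R) (x : F t) => Frame.Compat x y)]
      exact Nat.card_congr ((Equiv.prodComm _ _).subtypeEquiv fun _ => Iff.rfl)
    simp_rw [hc, Nat.cast_sum, Finset.sum_div]
    rw [finsum_sum_comm]
    · simp_rw [div_eq_mul_inv _ (autCard R : ℂ), ← finsum_mul]
      have : ∀ y : Y R, ∑ᶠ t, (Nat.card {x : F t // Frame.Compat x y} : ℂ) / edgesAutCard t = 1 :=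
        finsum_card_compat
      simp_rw [this, hallP_eq_card, ← Nat.cast_mul, ← Nat.card_prod]
      simp [Y]
    · intro y _
      refine (finite_nonempty_edgeFrame M.out N.out P.out Q.out).subset fun t ht => ?_
      by_contra h
      refine ht ?_
      have : IsEmpty {x : F t // Frame.Compat x y} := ⟨fun x => h ⟨x.1⟩⟩
      simp
  have h₂ : ∀ t : Edges C, ∑ᶠ R : IsoClass C, (c R t : ℂ) / edgesAutCard t / autCard R =
      (hallP t.1.1 t.1.2 M : ℂ) * hallP t.2.1 t.2.2 N * hallP t.1.1 t.2.1 P *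
        hallP t.1.2 t.2.2 Q / edgesAutCard t *
        ((Nat.card (Ext.{w} t.1.1.out t.2.2.out 1) : ℂ) /
          Nat.card (Ext.{w} t.1.1.out t.2.2.out 0)) := by
    intro t
    have hc : ∀ R, c R t = ∑ x : F t, Nat.card {y : Y R // Frame.Compat x y} := fun R =>
      card_subtype_prod_eq_sum (fun (x : F t) (y : Y R) => Frame.Compat x y)
    have hx : ∀ x : F t,
        ∑ᶠ R, (Nat.card {y : Y R // Frame.Compat x y} : ℂ) / autCard R =
          Nat.card (Ext.{w} t.1.1.out t.2.2.out 1) / Nat.card (Ext.{w} t.1.1.out t.2.2.out 0) :=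
      fun x => finsum_card_isCompatible.{w} x.1.1 x.1.2 x.2.1 x.2.2
    simp_rw [hc, div_right_comm _ (edgesAutCard t), Nat.cast_sum, Finset.sum_div]
    rw [finsum_sum_comm]
    · simp_rw [div_eq_mul_inv _ (edgesAutCard t), ← finsum_mul, hx]
      rw [Finset.sum_const, Finset.card_univ, ← Nat.card_eq_fintype_card]
      simp only [F, Nat.card_prod, hallP_eq_card, nsmul_eq_mul]
      push_cast
      ring
    · intro x _
      refine (finite_support_hallP.{w} M N).subset fun R hR h => hR ?_
      rw [hallP_eq_card, Finite.card_eq_zero_iff] at h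
      have : IsEmpty {y : Y R // Frame.Compat x y} := ⟨fun y => h.false y.1.1⟩
      simp
  simp_rw [h₁, ← h₂]
  refine finsum_comm_of_finite (finite_support_hallP.{w} M N)
    (finite_nonempty_edgeFrame M.out N.out P.out Q.out) _ fun R t h => ?_
  have hne : Nonempty {p : F t × Y R // Frame.Compat p.1 p.2} := by
    by_contra h'
    rw [not_nonempty_iff] at h'
    refine h ?_
    simp [c]
  obtain ⟨⟨x, y⟩, -⟩ := hne
  refine ⟨?_, ⟨x⟩⟩
  have : Nonempty (exactSeqs M.out N.out R.out) := ⟨y.1⟩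
  change hallP M N R ≠ 0
  rw [hallP_eq_card]
  exact Nat.card_pos.ne'

end Green

/-! ### Bilinearity of convergent products -/

section HasProduct

variable {I : Type*} {m : (I →₀ ℂ) →ₗ[ℂ] (I →₀ ℂ) →ₗ[ℂ] (I →₀ ℂ)} {t : I → I → ℂ}

variable (m t) in
/-- The product of `F` and `G` in the completed tensor square is convergent, with value `H`. -/
def HasProduct (F G H : I × I → ℂ) : Prop :=
  ∀ r : I × I, {x : (I × I) × (I × I) | F x.1 * G x.2 * tensorCoeff m t x.1 x.2 r ≠ 0}.Finite ∧
    ∑ᶠ x : (I × I) × (I × I), F x.1 * G x.2 * tensorCoeff m t x.1 x.2 r = H r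

theorem HasProduct.convergent {F G H : I × I → ℂ} (h : HasProduct m t F G H) :
    Convergent m t F G := fun r => (h r).1

theorem HasProduct.eq {F G H : I × I → ℂ} (h : HasProduct m t F G H) :
    H = completedMul m t F G := funext fun r => (h r).2.symm

theorem HasProduct.zero_left (G : I × I → ℂ) : HasProduct m t 0 G 0 := fun r => by simp

theorem HasProduct.zero_right (F : I × I → ℂ) : HasProduct m t F 0 0 := fun r => by simp

/-- A `finsum` with infinite support has the default value zero, so values add only under
convergence; this is why `HasProduct` carries both together. -/
theorem HasProduct.add_left {F F' G H H' : I × I → ℂ} (h : HasProduct m t F G H)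
    (h' : HasProduct m t F' G H') : HasProduct m t (F + F') G (H + H') := fun r => by
  simp only [Pi.add_apply, add_mul]
  refine ⟨((h r).1.union (h' r).1).subset fun x hx => ?_, ?_⟩
  · by_contra hx'
    simp only [Set.mem_union, Set.mem_ofPred_eq, not_or, not_not] at hx'
    exact hx (by rw [hx'.1, hx'.2, add_zero])
  · rw [finsum_add_distrib (h r).1 (h' r).1, (h r).2, (h' r).2]

theorem HasProduct.add_right {F G G' H H' : I × I → ℂ} (h : HasProduct m t F G H)
    (h' : HasProduct m t F G' H') : HasProduct m t F (G + G') (H + H') := fun r => by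
  simp only [Pi.add_apply, mul_add, add_mul]
  refine ⟨((h r).1.union (h' r).1).subset fun x hx => ?_, ?_⟩
  · by_contra hx'
    simp only [Set.mem_union, Set.mem_ofPred_eq, not_or, not_not] at hx'
    exact hx (by rw [hx'.1, hx'.2, add_zero])
  · rw [finsum_add_distrib (h r).1 (h' r).1, (h r).2, (h' r).2]

theorem HasProduct.smul {F G H : I × I → ℂ} (h : HasProduct m t F G H) (a b : ℂ) :
    HasProduct m t (a • F) (b • G) ((a * b) • H) := fun r => by
  have e : ∀ x : (I × I) × (I × I),
      (a • F) x.1 * (b • G) x.2 * tensorCoeff m t x.1 x.2 r =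
        (a * b) * (F x.1 * G x.2 * tensorCoeff m t x.1 x.2 r) := fun x => by
    simp only [Pi.smul_apply, smul_eq_mul]
    ring
  simp only [e]
  refine ⟨(h r).1.subset fun x hx => right_ne_zero_of_mul hx, ?_⟩
  rw [← mul_finsum, (h r).2, Pi.smul_apply, smul_eq_mul]

/-- A linear map to the completed tensor square is multiplicative if it is so on basis vectors. -/
theorem hasProduct_of_single (Δ : (I →₀ ℂ) →ₗ[ℂ] (I × I → ℂ))
    (h : ∀ i j, HasProduct m t (Δ (Finsupp.single i 1)) (Δ (Finsupp.single j 1))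
      (Δ (m (Finsupp.single i 1) (Finsupp.single j 1)))) (x y : I →₀ ℂ) :
    HasProduct m t (Δ x) (Δ y) (Δ (m x y)) := by
  induction x using Finsupp.induction_linear with
  | zero => simpa using HasProduct.zero_left _
  | add x x' hx hx' => simpa using hx.add_left hx'
  | single i a =>
    induction y using Finsupp.induction_linear with
    | zero => simpa using HasProduct.zero_right _
    | add y y' hy hy' => simpa using hy.add_right hy'
    | single j b =>
      rw [← mul_one a, ← mul_one b, ← smul_eq_mul, ← smul_eq_mul, ← Finsupp.smul_single,
        ← Finsupp.smul_single]
      simp only [map_smul, LinearMap.smul_apply, smul_smul]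
      rw [mul_comm b a]
      exact (h i j).smul a b

end HasProduct

/-! ### Multiplicativity of the twisted coproduct on basis vectors -/

section Coefficients

variable {C : Type u} [Category.{v} C] [Abelian C]

theorem K0.of_out (M : IsoClass C) : K0.of M.out = M.toK0 :=
  congrArg IsoClass.toK0 (Quotient.out_eq M)

theorem toK0_eq_of_hallP_ne_zero {M N R : IsoClass C} (h : hallP M N R ≠ 0) :
    R.toK0 = N.toK0 + M.toK0 := by
  obtain ⟨x, hx⟩ := Set.nonempty_of_ncard_ne_zero h
  have := K0.of_shortExact hx.choose_spec
  dsimp at this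
  rwa [K0.of_out, K0.of_out, K0.of_out] at this

variable [HasExt.{w} C] (E : EulerForm.{w} C)

theorem EulerForm.form_sq [Finitary.{w} C] [Hereditary C] (M N : IsoClass C) :
    E.form M.toK0 N.toK0 ^ 2 =
      Nat.card (Ext.{w} M.out N.out 0) / Nat.card (Ext.{w} M.out N.out 1) := by
  have h := E.sq M.out N.out
  rw [K0.of_out, K0.of_out, eulerSq_eq] at h
  rw [h]
  push_cast
  rfl

theorem hallBasisMul_apply [Finitary.{w} C] (M N R : IsoClass C) :
    hallBasisMul E M N R = E.form M.toK0 N.toK0 *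
      (1 / ((autCard M : ℂ) * (autCard N : ℂ)) * (hallP M N R : ℂ)) := rfl

theorem hallMul_single [Finitary.{w} C] (M N : IsoClass C) :
    hallMul E (Finsupp.single M 1) (Finsupp.single N 1) = hallBasisMul E M N := by
  simp [hallMul]

theorem hallComul_single (R : IsoClass C) (p : IsoClass C × IsoClass C) :
    hallComul E (Finsupp.single R 1) p =
      E.form p.1.toK0 p.2.toK0 * (1 / (autCard R : ℂ)) * (hallP p.1 p.2 R : ℂ) := by
  simp [hallComul]

theorem hallComul_apply (x : HallAlgebra C) (p : IsoClass C × IsoClass C) :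
    hallComul E x p = ∑ᶠ R, x R *
      (E.form p.1.toK0 p.2.toK0 * (1 / (autCard R : ℂ)) * (hallP p.1 p.2 R : ℂ)) := by
  rw [finsum_eq_sum_of_support_subset (s := x.support)]
  · simp [hallComul, Finsupp.linearCombination_apply, Finsupp.sum, Finset.sum_apply]
  · intro R hR
    simpa using left_ne_zero_of_mul hR

/-- With `M = A + B`, `N = G + D`, `P = A + G`, `Q = B + D` in the Grothendieck group, `⟨M, N⟩ₘ⟨P,
Q⟩ₘ` is `⟨A, D⟩ₘ²` times the twist `⟨A, B⟩ₘ⟨G, D⟩ₘ(B, G)ₘ⟨A, G⟩ₘ⟨B, D⟩ₘ` of the product of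
coproducts. The last factor in Green's formula is `⟨A, D⟩ₘ⁻²`. -/
theorem hasProduct_hallComul_single [Finitary.{w} C] [Hereditary C] (M N : IsoClass C) :
    HasProduct (hallMul E) (fun N P => E.symm N.toK0 P.toK0)
      (hallComul E (Finsupp.single M 1)) (hallComul E (Finsupp.single N 1))
      (hallComul E (hallMul E (Finsupp.single M 1) (Finsupp.single N 1))) := by
  have := Finitary.finite_hom.{w} (C := C)
  rintro ⟨P, Q⟩
  let K : ℂ := E.form M.toK0 N.toK0 * E.form P.toK0 Q.toK0 / (autCard M * autCard N)
  let g : Edges C → ℂ := fun t => (hallP t.1.1 t.1.2 M : ℂ) * hallP t.2.1 t.2.2 N *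
    hallP t.1.1 t.2.1 P * hallP t.1.2 t.2.2 Q / edgesAutCard t *
      ((Nat.card (Ext.{w} t.1.1.out t.2.2.out 1) : ℂ) / Nat.card (Ext.{w} t.1.1.out t.2.2.out 0))
  have term : ∀ t : Edges C, hallComul E (Finsupp.single M 1) t.1 *
      hallComul E (Finsupp.single N 1) t.2 *
        tensorCoeff (hallMul E) (fun N P => E.symm N.toK0 P.toK0) t.1 t.2 (P, Q) = K * g t := by
    rintro ⟨⟨A, B⟩, G, D⟩
    simp only [hallComul_single, tensorCoeff, hallMul_single, hallBasisMul_apply, K, g,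
      edgesAutCard]
    -- The relations between classes hold only if the four sequences exist; otherwise both sides
    -- vanish.
    by_cases h₁ : hallP A B M = 0
    · simp [h₁]
    by_cases h₂ : hallP G D N = 0
    · simp [h₂]
    by_cases h₃ : hallP A G P = 0
    · simp [h₃]
    by_cases h₄ : hallP B D Q = 0
    · simp [h₄]
    have hsq := E.form_sq A D
    have h0 : (Nat.card (Ext.{w} A.out D.out 0) : ℂ) ≠ 0 := by exact_mod_cast Nat.card_pos.ne'
    have h1 : (Nat.card (Ext.{w} A.out D.out 1) : ℂ) ≠ 0 := by exact_mod_cast Nat.card_pos.ne'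
    rw [eq_div_iff h1] at hsq
    rw [toK0_eq_of_hallP_ne_zero h₁, toK0_eq_of_hallP_ne_zero h₂, toK0_eq_of_hallP_ne_zero h₃,
      toK0_eq_of_hallP_ne_zero h₄]
    simp only [EulerForm.symm, E.add_left, E.add_right]
    have hA := autCard_ne_zero A
    have hB := autCard_ne_zero B
    have hG := autCard_ne_zero G
    have hD := autCard_ne_zero D
    have hM := autCard_ne_zero M
    have hN := autCard_ne_zero N
    rw [← hsq]
    have hf : E.form A.toK0 D.toK0 ≠ 0 := fun h => h0 (by rw [← hsq, h]; ring)
    field_simp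
  simp only [term]
  refine ⟨(finite_nonempty_edgeFrame M.out N.out P.out Q.out).subset fun t ht => ?_, ?_⟩
  · have h := left_ne_zero_of_mul (right_ne_zero_of_mul ht)
    rw [div_ne_zero_iff] at h
    have h := h.1
    simp only [hallP_eq_card, ← Nat.cast_mul, ← Nat.card_prod, Nat.cast_ne_zero] at h
    obtain ⟨⟨⟨⟨x₁, x₂⟩, x₃⟩, x₄⟩⟩ := (Nat.card_ne_zero.1 h).1
    exact ⟨(x₁, x₂), (x₃, x₄)⟩
  · rw [← mul_finsum, ← green_formula, hallMul_single, hallComul_apply, mul_finsum]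
    refine finsum_congr fun R => ?_
    simp only [hallBasisMul_apply, K]
    ring

end Coefficients

/-! ### The coproduct of the unit -/

section Unit

variable {C : Type u} [Category.{v} C] [Abelian C]

theorem isZero_out_zero : Limits.IsZero (isoClass (0 : C)).out :=
  (Limits.isZero_zero C).of_iso (out_iso (0 : C)).some

theorem isoClass_eq_zero_of_isZero {M : IsoClass C} (h : Limits.IsZero M.out) :
    M = isoClass (0 : C) :=
  isoClass_eq_of_iso (h.iso isZero_out_zero)

theorem autCard_zero : autCard (isoClass (0 : C)) = 1 := by
  have : Subsingleton (Aut (isoClass (0 : C)).out) :=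
    ⟨fun _ _ => Iso.ext (isZero_out_zero.eq_of_src _ _)⟩
  exact Nat.card_of_subsingleton 1

theorem hallP_zero : hallP (isoClass (0 : C)) (isoClass 0) (isoClass 0) = 1 := by
  have h0 := isZero_out_zero (C := C)
  have hmem : ((0 : (isoClass (0 : C)).out ⟶ (isoClass (0 : C)).out),
      (0 : (isoClass (0 : C)).out ⟶ (isoClass (0 : C)).out)) ∈
      exactSeqs (isoClass (0 : C)).out (isoClass (0 : C)).out (isoClass (0 : C)).out :=
    mem_exactSeqs_of_lift (h0.eq_of_src _ _) ⟨fun _ _ _ => h0.eq_of_tgt _ _⟩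
      ⟨fun _ _ _ => h0.eq_of_src _ _⟩ fun _ _ => ⟨0, h0.eq_of_tgt _ _⟩
  rw [hallP, Set.ncard_eq_one]
  exact ⟨_, Set.eq_singleton_iff_unique_mem.2
    ⟨hmem, fun x _ => Prod.ext (h0.eq_of_src _ _) (h0.eq_of_src _ _)⟩⟩

theorem eq_zero_of_hallP_zero_ne_zero {M N : IsoClass C} (h : hallP M N (isoClass 0) ≠ 0) :
    M = isoClass (0 : C) ∧ N = isoClass (0 : C) := by
  obtain ⟨x, hx⟩ := Set.nonempty_of_ncard_ne_zero h
  have := exactSeqs_mono hx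
  have := exactSeqs_epi hx
  exact ⟨isoClass_eq_zero_of_isZero (isZero_out_zero.of_epi x.2),
    isoClass_eq_zero_of_isZero (isZero_out_zero.of_mono x.1)⟩

theorem toK0_zero : (isoClass (0 : C)).toK0 = 0 := K0.of_isZero (Limits.isZero_zero C)

variable [HasExt.{w} C] (E : EulerForm.{w} C)

theorem EulerForm.form_ne_zero [Finitary.{w} C] [Hereditary C] (M N : IsoClass C) :
    E.form M.toK0 N.toK0 ≠ 0 := by
  intro h
  have h' := E.form_sq M N
  rw [h, zero_pow two_ne_zero] at h'
  have : (Nat.card (Ext.{w} M.out N.out 0) : ℂ) / Nat.card (Ext.{w} M.out N.out 1) ≠ 0 :=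
    div_ne_zero (by exact_mod_cast Nat.card_pos.ne') (by exact_mod_cast Nat.card_pos.ne')
  exact this h'.symm

/-- Multiplicativity makes this value idempotent; it is nonzero because its square is a quotient of
orders of finite groups. -/
theorem EulerForm.form_zero_zero [Finitary.{w} C] [Hereditary C] : E.form 0 0 = 1 := by
  have h := E.add_left 0 0 0
  have hne := E.form_ne_zero (isoClass (0 : C)) (isoClass 0)
  rw [toK0_zero] at hne
  rw [add_zero] at h
  exact (mul_eq_left₀ hne).1 h.symm

theorem hallComul_hallOne [Finitary.{w} C] [Hereditary C] :
    hallComul E (hallOne C) = pureTensor (hallOne C) (hallOne C) := by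
  classical
  ext ⟨M, N⟩
  simp only [hallOne, hallComul_single, pureTensor, Finsupp.single_apply]
  by_cases h : hallP M N (isoClass (0 : C)) = 0
  · rw [h, Nat.cast_zero, mul_zero]
    by_cases hM : isoClass (0 : C) = M
    · by_cases hN : isoClass (0 : C) = N
      · subst hM hN
        rw [hallP_zero] at h
        exact absurd h one_ne_zero
      · rw [if_neg hN, mul_zero]
    · rw [if_neg hM, zero_mul]
  · obtain ⟨rfl, rfl⟩ := eq_zero_of_hallP_zero_ne_zero h
    simp [hallP_zero, autCard_zero, toK0_zero, E.form_zero_zero]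

end Unit

/-! ### The extended Hall algebra -/

section Extended

variable {C : Type u} [Category.{v} C] [Abelian C]

/-- The labels by elements of the Grothendieck group occurring in the product of two coproducts. -/
def edgesLabel (α β : K0 C) (t : Edges C) :
    ((IsoClass C × K0 C) × (IsoClass C × K0 C)) × ((IsoClass C × K0 C) × (IsoClass C × K0 C)) :=
  (((t.1.1, t.1.2.toK0 + α), (t.1.2, α)), ((t.2.1, t.2.2.toK0 + β), (t.2.2, β)))

theorem edgesLabel_injective (α β : K0 C) : Function.Injective (edgesLabel α β) := by
  rintro ⟨⟨A, B⟩, G, D⟩ ⟨⟨A', B'⟩, G', D'⟩ h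
  simp only [edgesLabel, Prod.mk.injEq] at h
  obtain ⟨⟨⟨rfl, -⟩, rfl, -⟩, ⟨rfl, -⟩, rfl, -⟩ := h
  rfl

variable [HasExt.{w} C] (E : EulerForm.{w} C)

theorem extHallMul_single [Finitary.{w} C] (x y : IsoClass C × K0 C) :
    extHallMul E (Finsupp.single x 1) (Finsupp.single y 1) =
      E.symm x.2 y.1.toK0 • (hallBasisMul E x.1 y.1).mapDomain fun R => (R, x.2 + y.2) := by
  simp [extHallMul]

open scoped Classical in
theorem extHallMul_single_apply [Finitary.{w} C] (x y z : IsoClass C × K0 C) :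
    extHallMul E (Finsupp.single x 1) (Finsupp.single y 1) z =
      if z.2 = x.2 + y.2 then E.symm x.2 y.1.toK0 * hallBasisMul E x.1 y.1 z.1 else 0 := by
  rw [extHallMul_single, Finsupp.smul_apply, smul_eq_mul]
  obtain ⟨R, γ⟩ := z
  split_ifs with h
  · dsimp at h
    subst h
    rw [Finsupp.mapDomain_apply (f := fun R : IsoClass C => (R, x.2 + y.2))
      (fun R R' h => (Prod.mk.inj h).1)]
  · rw [Finsupp.mapDomain_of_notMem_range, mul_zero]
    rintro ⟨R', hR'⟩
    exact h (Prod.mk.inj hR').2.symm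

open scoped Classical in
theorem extHallComul_single (x : IsoClass C × K0 C)
    (p : (IsoClass C × K0 C) × (IsoClass C × K0 C)) :
    extHallComul E (Finsupp.single x 1) p =
      if p.1.2 = p.2.1.toK0 + x.2 ∧ p.2.2 = x.2 then
        hallComul E (Finsupp.single x.1 1) (p.1.1, p.2.1) else 0 := by
  simp [extHallComul, hallComul_single]

open scoped Classical in
theorem extHallComul_mapDomain (f : HallAlgebra C) (α : K0 C)
    (p : (IsoClass C × K0 C) × (IsoClass C × K0 C)) :
    extHallComul E (f.mapDomain fun R => (R, α)) p =
      if p.1.2 = p.2.1.toK0 + α ∧ p.2.2 = α then hallComul E f (p.1.1, p.2.1) else 0 := by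
  induction f using Finsupp.induction_linear with
  | zero => simp
  | add f g hf hg =>
    rw [Finsupp.mapDomain_add, map_add, map_add, Pi.add_apply, hf, hg, Pi.add_apply]
    split_ifs <;> simp
  | single R c =>
    rw [Finsupp.mapDomain_single, ← mul_one c, ← smul_eq_mul, ← Finsupp.smul_single,
      ← Finsupp.smul_single, map_smul, map_smul, Pi.smul_apply, Pi.smul_apply,
      extHallComul_single]
    split_ifs <;> simp

theorem extHallComul_extHallOne [Finitary.{w} C] [Hereditary C] :
    extHallComul E (extHallOne C) = pureTensor (extHallOne C) (extHallOne C) := by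
  classical
  ext ⟨⟨M, γ⟩, N, δ⟩
  have h := congrFun (hallComul_hallOne E) (M, N)
  simp only [hallOne, pureTensor, Finsupp.single_apply] at h
  simp only [extHallOne, extHallComul_single, pureTensor, Finsupp.single_apply, h, Prod.mk.injEq]
  by_cases hN : isoClass (0 : C) = N
  · subst hN
    simp only [toK0_zero]
    by_cases hM : isoClass (0 : C) = M <;> by_cases hγ : γ = 0 <;> by_cases hδ : δ = 0 <;>
      simp [hM, hγ, hδ, eq_comm]
  · simp [hN]

/-- Moving `k_{B+α}` past `[G]` and `k_α` past `[D]` gives `(B + α, G)ₘ(α, D)ₘ = (B, G)ₘ(α, N)ₘ`.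
The first factor is the twist of the previous case, and the second is the scalar in `[M]k_α ·
[N]k_β`. The labels match since `B + D = Q`. -/
theorem hasProduct_extHallComul_single [Finitary.{w} C] [Hereditary C] (x y : IsoClass C × K0 C) :
    HasProduct (extHallMul E) (fun _ _ => 1)
      (extHallComul E (Finsupp.single x 1)) (extHallComul E (Finsupp.single y 1))
      (extHallComul E (extHallMul E (Finsupp.single x 1) (Finsupp.single y 1))) := by
  classical
  obtain ⟨M, α⟩ := x
  obtain ⟨N, β⟩ := y
  rintro ⟨⟨P, γ⟩, Q, δ⟩
  obtain ⟨hfin, hsum⟩ := hasProduct_hallComul_single E M N (P, Q)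
  let F : ((IsoClass C × K0 C) × (IsoClass C × K0 C)) ×
      ((IsoClass C × K0 C) × (IsoClass C × K0 C)) → ℂ := fun z =>
    extHallComul E (Finsupp.single (M, α) 1) z.1 * extHallComul E (Finsupp.single (N, β) 1) z.2 *
      tensorCoeff (extHallMul E) (fun _ _ => 1) z.1 z.2 ((P, γ), (Q, δ))
  let f : Edges C → ℂ := fun z =>
    hallComul E (Finsupp.single M 1) z.1 * hallComul E (Finsupp.single N 1) z.2 *
      tensorCoeff (hallMul E) (fun N P => E.symm N.toK0 P.toK0) z.1 z.2 (P, Q)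
  let c : ℂ := if γ = Q.toK0 + (α + β) ∧ δ = α + β then E.symm α N.toK0 else 0
  -- The coproducts force all labels, so the sum over labelled quadruples is a sum over edges.
  have hrange : ∀ z, F z ≠ 0 → z ∈ Set.range (edgesLabel α β) := by
    rintro ⟨⟨⟨A, a⟩, B, b⟩, ⟨G, g⟩, D, d⟩ hz
    have h₁ := left_ne_zero_of_mul (left_ne_zero_of_mul hz)
    have h₂ := right_ne_zero_of_mul (left_ne_zero_of_mul hz)
    rw [extHallComul_single] at h₁ h₂
    obtain ⟨ha, hb⟩ := (ite_ne_right_iff.1 h₁).1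
    obtain ⟨hg, hd⟩ := (ite_ne_right_iff.1 h₂).1
    dsimp at ha hb hg hd
    subst ha hb hg hd
    exact ⟨((A, B), (G, D)), rfl⟩
  have hF : ∀ t, F (edgesLabel α β t) = c * f t := by
    rintro ⟨⟨A, B⟩, G, D⟩
    simp only [F, f, c, edgesLabel, tensorCoeff, extHallComul_single, extHallMul_single_apply,
      hallMul_single, and_self, if_true, one_mul]
    by_cases hBDQ : hallP B D Q = 0
    · simp [hallBasisMul_apply, hBDQ]
    by_cases hGDN : hallP G D N = 0
    · simp [hallComul_single, hGDN]
    by_cases hδ : δ = α + β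
    · by_cases hγ : γ = Q.toK0 + (α + β)
      · have hγ' : γ = B.toK0 + α + (D.toK0 + β) := by
          rw [hγ, toK0_eq_of_hallP_ne_zero hBDQ]
          abel
        rw [if_pos hγ', if_pos hδ, if_pos ⟨hγ, hδ⟩, toK0_eq_of_hallP_ne_zero hGDN]
        simp only [EulerForm.symm, E.add_left, E.add_right]
        ring
      · have hγ' : ¬ γ = B.toK0 + α + (D.toK0 + β) := fun h => hγ (by
          rw [h, toK0_eq_of_hallP_ne_zero hBDQ]
          abel)
        simp [hγ, hγ']
    · simp [hδ]
  refine ⟨(hfin.image (edgesLabel α β)).subset fun z hz => ?_, ?_⟩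
  · obtain ⟨t, rfl⟩ := hrange z hz
    have hz' : F (edgesLabel α β t) ≠ 0 := hz
    rw [hF] at hz'
    exact ⟨t, right_ne_zero_of_mul hz', rfl⟩
  · have hsum' : ∑ᶠ t, f t = _ := hsum
    have h₁ : ∑ᶠ z, F z = ∑ᶠ t, F (edgesLabel α β t) := by
      rw [← finsum_mem_range (edgesLabel_injective α β), finsum_mem_def]
      refine finsum_congr fun z => (Set.indicator_apply_eq_self.2 fun hz => ?_).symm
      by_contra h
      exact hz (hrange z h)
    change ∑ᶠ z, F z = _
    rw [h₁]
    simp only [hF]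
    rw [← mul_finsum, hsum', extHallMul_single, map_smul, Pi.smul_apply, extHallComul_mapDomain, hallMul_single]
    simp only [c, smul_eq_mul]
    split_ifs <;> simp

end Extended

end HallAlg

theorem mainTheorem1 {C : Type u} [Category.{v} C] [Abelian C] [HasExt.{w} C]
    [HallAlg.Finitary.{w} C] [HallAlg.Hereditary C] (E : HallAlg.EulerForm.{w} C) :
    (HallAlg.hallComul E (HallAlg.hallOne C) =
        HallAlg.pureTensor (HallAlg.hallOne C) (HallAlg.hallOne C) ∧
      ∀ x y : HallAlg.HallAlgebra C,
        HallAlg.Convergent (HallAlg.hallMul E) (fun N P => E.symm N.toK0 P.toK0)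
            (HallAlg.hallComul E x) (HallAlg.hallComul E y) ∧
          HallAlg.hallComul E (HallAlg.hallMul E x y) =
            HallAlg.completedMul (HallAlg.hallMul E) (fun N P => E.symm N.toK0 P.toK0)
              (HallAlg.hallComul E x) (HallAlg.hallComul E y)) ∧
    (HallAlg.extHallComul E (HallAlg.extHallOne C) =
        HallAlg.pureTensor (HallAlg.extHallOne C) (HallAlg.extHallOne C) ∧
      ∀ x y : HallAlg.ExtHallAlgebra C,
        HallAlg.Convergent (HallAlg.extHallMul E) (fun _ _ => 1)
            (HallAlg.extHallComul E x) (HallAlg.extHallComul E y) ∧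
          HallAlg.extHallComul E (HallAlg.extHallMul E x y) =
            HallAlg.completedMul (HallAlg.extHallMul E) (fun _ _ => 1)
              (HallAlg.extHallComul E x) (HallAlg.extHallComul E y)) := by
  refine ⟨⟨HallAlg.hallComul_hallOne E, fun x y => ?_⟩,
    HallAlg.extHallComul_extHallOne E, fun x y => ?_⟩
  · have h := HallAlg.hasProduct_of_single (HallAlg.hallComul E)
      (HallAlg.hasProduct_hallComul_single E) x y
    exact ⟨h.convergent, h.eq⟩
  · have h := HallAlg.hasProduct_of_single (HallAlg.extHallComul E)
      (HallAlg.hasProduct_extHallComul_single E) x y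
    exact ⟨h.convergent, h.eq⟩
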